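/- **Setting.** Let $\mathcal H$ be an infinite-dimensional separable real Hilbert space (for instance $L^2[0,1]$) and write $\zeta_1\otimes\zeta_2$ for the operator $\zeta\mapsto\langle\zeta_1,\zeta\rangle\zeta_2$; $\|\cdot\|_{\rm op}$ and $\|\cdot\|_{\rm HS}$ are the operator and Hilbert–Schmidt norms. Let $x_t,y_t,z_t,u_t$ $(t\ge1)$ be mean-zero, $\mathcal H$-valued random variables with $$y_t=\mathcal A x_t+u_t,\qquad \mathbb E[x_t\otimes u_t]\neq0,\quad \mathbb E[x_t\otimes z_t]\ne0,\quad \mathbb E[u_t\otimes z_t]=0,$$ where $\mathcal A$ is a bounded linear operator on $\mathcal H$. For $a,b\in\{x,y,z,u\}$ put $\mathcal C_{ab}=\mathbb E[a_1\otimes b_1]$ and $\widehat{\mathcal C}_{ab}=T^{-1}\sum_{t=1}^Ta_t\otimes b_t$. **Estimator.** Let $\hat\lambda_1^2\ge\hat\lambda_2^2\ge\dots\ge0$ and $\hat f_1,\hat f_2,\dots$ be the eigenvalues (with multiplicity) and an orthonormal basis of corresponding eigenvectors of $\widehat{\mathcal C}_{xz}^*\widehat{\mathcal C}_{xz}$.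 For a deterministic threshold $\alpha=\alpha_T>0$ let $$\mathrm K=\#\{j:\hat\lambda_j^2>\alpha\},\qquad \widehat\Pi_{\mathrm K}=\sum_{j=1}^{\mathrm K}\hat f_j\otimes\hat f_j,\qquad \widehat{\mathcal A}=\widehat{\mathcal C}_{yz}^*\widehat{\mathcal C}_{xz}\sum_{j=1}^{\mathrm K}\hat\lambda_j^{-2}\hat f_j\otimes\hat f_j .$$ **Assumptions.** Let $\mathfrak F_{t}=\sigma(\{z_s\}_{s\le t+1},\{u_s\}_{s\le t})$. 1. $\{(x_t,z_t)\}_{t\ge1}$ is strictly stationary and geometrically strongly mixing, and $\mathbb E\|x_t\|^2$, $\mathbb E\|z_t\|^2$, $\mathbb E\|u_t\|^2$ are finite. 2. $\mathbb E[u_t\mid\mathfrak F_{t-1}]=0$, $\mathbb E[u_t\otimes u_t\mid\mathfrak F_{t-1}]=\mathcal C_{uu}$, and, for some $\delta>0$ and every $T$, $\sup_{1\le t\le T}\mathbb E[\|u_t\|^{2+\delta}\mid\mathfrak F_{t-1}]<\infty$ almost surely. 3. $\ker\mathcal C_{xz}^*\mathcal C_{xz}=\{0\}$ and $\|\mathcal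 A\|_{\rm HS}<\infty$. There are orthonormal bases $\{f_j\}_{j\ge1}$, $\{\xi_j\}_{j\ge1}$ of $\mathcal H$ and real numbers $\lambda_j$ with $\lambda_1^2>\lambda_2^2>\dots>0$ such that $\mathcal C_{xz}f_j=\lambda_j\xi_j$ and $\mathcal C_{xz}^*\xi_j=\lambda_jf_j$; so $\lambda_j^2$ are the eigenvalues of $\mathcal C_{xz}^*\mathcal C_{xz}$ and of $\mathcal C_{xz}\mathcal C_{xz}^*$, with eigenvectors $f_j$ and $\xi_j$. 4. $\|\widehat{\mathcal C}_{xz}-\mathcal C_{xz}\|_{\rm HS}$, $\|\widehat{\mathcal C}_{zz}-\mathcal C_{zz}\|_{\rm HS}$, $\|\widehat{\mathcal C}_{uz}-\mathcal C_{uz}\|_{\rm HS}$ are $O_p(T^{-1/2})$, and $\|\widehat{\mathcal C}_{uu}-\mathcal C_{uu}\|_{\rm HS}=o_p(1)$. 5. There are constants $c_\circ>0$, $\rho>2$, $\varsigma>1/2$, $\gamma>1/2$, $m>1$ such that, with $\upsilon_t(j,\ell)=\langle x_t,f_j\rangle\langle z_t,\xi_\ell\rangle-\mathbb E[\langle x_t,f_j\rangle\langle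 z_t,\xi_\ell\rangle]$, for all $j,\ell,s\ge1$ and $t>s$: (a) $\lambda_j^2\le c_\circ j^{-\rho}$; (b) $\lambda_j^2-\lambda_{j+1}^2\ge c_\circ^{-1}j^{-\rho-1}$; (c) $|\langle\mathcal Af_j,\xi_\ell\rangle|\le c_\circ j^{-\varsigma}\ell^{-\gamma}$; (d) $\mathbb E[\upsilon_t(j,\ell)\upsilon_{t-s}(j,\ell)]\le c_\circ s^{-m}\,\mathbb E[\upsilon_t(j,\ell)^2]$, and, for all $t\ge 1$, $\mathbb E\big[\|\langle x_t,f_j\rangle z_t\|^2\big]\le c_\circ|\lambda_j|$ and $\mathbb E\big[\|\langle z_t,\xi_j\rangle x_t\|^2\big]\le c_\circ|\lambda_j|$. **Theorem.** Suppose in addition that $\alpha\to0$ and $\alpha^{-1}=o\big(T^{\rho/(2\rho+2)}\big)$ as $T\to\infty$. Then $$\|\widehat{\mathcal A}-\mathcal A\widehat\Pi_{\mathrm K}\|_{\rm op}^2=O_p(T^{-1}\alpha^{-1}),$$ $$\|\mathcal A(\mathcal I-\widehat\Pi_{\mathrm K})\|_{\rm op}^2=O_p\Big(T^{-1}\alpha^{-1}\max\{1,\alpha^{(2\varsigma-3)/\rho}\}+\alpha^{(2\varsigma-1)/\rho}\Big),$$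 and hence $\|\widehat{\mathcal A}-\mathcal A\|_{\rm op}=o_p(1)$. -/

import Mathlib

open MeasureTheory Filter Topology
open scoped ENNReal InnerProductSpace

namespace FIVE

noncomputable section

/-! Conventions. Time `t : ℕ` and the indices `j, l : ℕ` of eigenelements start at `0`, so the
sample of size `T` consists of the times `0, …, T - 1`, and the `j`-th eigenvalue in the usual
numbering is the one with index `j - 1` here (powers of the index appear as `(j + 1) ^ p`). -/

section Operators

variable {H : Type*} [NormedAddCommGroup H] [InnerProductSpace ℝ H]

/-- The tensor product `a ⊗ b`, that is the operator `v ↦ ⟪a, v⟫ b`. -/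
def tensor (a b : H) : H →L[ℝ] H := InnerProductSpace.rankOne ℝ b a

theorem tensor_apply (a b v : H) : tensor a b v = ⟪a, v⟫_ℝ • b := by
  simp [tensor]

/-- `ev j, e j` (`j = 0, 1, …`) are the eigenvalues, in decreasing order and repeated according to
their multiplicities, and the eigenvectors of `S`, the latter forming an orthonormal basis of the
space: `S = ∑ⱼ ev j • (e j ⊗ e j)`. -/
structure IsEigenSystem (S : H →L[ℝ] H) (ev : ℕ → ℝ) (e : HilbertBasis ℕ ℝ H) : Prop where
  antitone : Antitone ev
  apply_eq : ∀ j, S (e j) = ev j • e j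

/-- Parseval's identity in `[0, ∞]`. -/
theorem parseval {ι : Type*} (b : HilbertBasis ι ℝ H) (v : H) :
    ‖v‖ₑ ^ 2 = ∑' i, ‖⟪v, b i⟫_ℝ‖ₑ ^ 2 := by
  have h := b.hasSum_inner_mul_inner v v
  have h1 : ∀ i, ⟪v, b i⟫_ℝ * ⟪b i, v⟫_ℝ = ‖⟪v, b i⟫_ℝ‖ ^ 2 := by
    intro i
    rw [real_inner_comm v (b i), Real.norm_eq_abs, sq_abs, sq]
  simp only [h1] at h
  have h2 : ∀ i, ‖⟪v, b i⟫_ℝ‖ₑ ^ 2 = ENNReal.ofReal (‖⟪v, b i⟫_ℝ‖ ^ 2) := by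
    intro i
    rw [ENNReal.ofReal_pow (norm_nonneg _), ofReal_norm]
  simp only [h2]
  rw [← ENNReal.ofReal_tsum_of_nonneg (fun i => sq_nonneg _) h.summable, h.tsum_eq,
    real_inner_self_eq_norm_sq, ENNReal.ofReal_pow (norm_nonneg _), ofReal_norm]

/-- The number `K` of eigenvalues that exceed the threshold `a`. -/
def truncIndex (a : ℝ) (ev : ℕ → ℝ) : ℕ := Set.ncard {j | a < ev j}

/-- The orthogonal projection `∑_{j ≤ K} eⱼ ⊗ eⱼ`. -/
def truncProj (a : ℝ) (ev : ℕ → ℝ) (e : ℕ → H) : H →L[ℝ] H :=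
  ∑ j ∈ Finset.range (truncIndex a ev), tensor (e j) (e j)

/-- The rank-regularized inverse `∑_{j ≤ K} evⱼ⁻¹ eⱼ ⊗ eⱼ`. -/
def regInverse (a : ℝ) (ev : ℕ → ℝ) (e : ℕ → H) : H →L[ℝ] H :=
  ∑ j ∈ Finset.range (truncIndex a ev), (ev j)⁻¹ • tensor (e j) (e j)

variable [CompleteSpace H]

/-- The adjoint of a bounded operator. -/
abbrev adj (S : H →L[ℝ] H) : H →L[ℝ] H := ContinuousLinearMap.adjoint S

variable (H) in
/-- The index set of some orthonormal basis of `H`. -/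
def refIndex : Set H := (exists_hilbertBasis ℝ H).choose

variable (H) in
/-- Some orthonormal basis of `H`. -/
def refBasis : HilbertBasis (refIndex H) ℝ H := (exists_hilbertBasis ℝ H).choose_spec.choose

/-- The Hilbert-Schmidt norm `(∑ᵢ ‖S eᵢ‖²)^(1/2)`, with values in `[0, ∞]`, computed in some
orthonormal basis; by `hsNorm_eq` below it does not depend on the basis. -/
def hsNorm (S : H →L[ℝ] H) : ℝ≥0∞ := (∑' i, ‖S (refBasis H i)‖ₑ ^ 2) ^ (1 / 2 : ℝ)

theorem tsum_sq_swap {ι κ : Type*} (b : HilbertBasis ι ℝ H) (c : HilbertBasis κ ℝ H)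
    (S : H →L[ℝ] H) : ∑' i, ‖S (b i)‖ₑ ^ 2 = ∑' k, ‖adj S (c k)‖ₑ ^ 2 := by
  have h1 : ∀ i, ‖S (b i)‖ₑ ^ 2 = ∑' k, ‖⟪S (b i), c k⟫_ℝ‖ₑ ^ 2 := fun i => parseval c _
  have h2 : ∀ k, ‖adj S (c k)‖ₑ ^ 2 = ∑' i, ‖⟪S (b i), c k⟫_ℝ‖ₑ ^ 2 := by
    intro k
    rw [parseval b]
    refine tsum_congr fun i => ?_
    rw [ContinuousLinearMap.adjoint_inner_left, real_inner_comm]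
  simp only [h1, h2]
  exact ENNReal.tsum_comm

/-- The Hilbert-Schmidt norm can be computed in every orthonormal basis. -/
theorem hsNorm_eq {ι : Type*} (b : HilbertBasis ι ℝ H) (S : H →L[ℝ] H) :
    hsNorm S = (∑' i, ‖S (b i)‖ₑ ^ 2) ^ (1 / 2 : ℝ) := by
  rw [hsNorm, tsum_sq_swap (refBasis H) b S, ← tsum_sq_swap b b S]

/-- A positive operator of finite rank on a separable space of infinite dimension has an ordered
orthonormal basis of eigenvectors. -/
theorem exists_isEigenSystem [TopologicalSpace.SeparableSpace H] (hH : ¬ FiniteDimensional ℝ H)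
    (S : H →L[ℝ] H) (hS : S.IsPositive) (hfin : FiniteDimensional ℝ S.toLinearMap.range) :
    ∃ (ev : ℕ → ℝ) (e : HilbertBasis ℕ ℝ H), IsEigenSystem S ev e := by
  classical
  set V : Submodule ℝ H := S.toLinearMap.range with hV
  have hsym : S.toLinearMap.IsSymmetric := hS.isSymmetric
  have hinv : ∀ v ∈ V, S.toLinearMap v ∈ V := fun v _ => ⟨v, rfl⟩
  have hT := hsym.restrict_invariant hinv
  set n := Module.finrank ℝ V with hn
  set v := hT.eigenvectorBasis hn.symm with hv
  set lam := hT.eigenvalues hn.symm with hlam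
  have heig : ∀ i, S (v i : H) = lam i • (v i : H) := fun i =>
    congrArg Subtype.val (hT.apply_eigenvectorBasis hn.symm i)
  have hlam0 : ∀ i, 0 ≤ lam i := by
    intro i
    have h2 := hS.inner_nonneg_right (v i : H)
    have h4 : ‖(v i : H)‖ = 1 := v.orthonormal.1 i
    rw [heig, inner_smul_right, real_inner_self_eq_norm_sq, h4] at h2
    simpa using h2
  obtain ⟨w, b, hb⟩ := exists_hilbertBasis ℝ Vᗮ
  have hwon : Orthonormal ℝ ((↑) : w → Vᗮ) := hb ▸ b.orthonormal
  have hwc : Countable w := by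
    refine Pairwise.countable_of_isOpen_disjoint (s := fun i : w => Metric.ball (i : Vᗮ) (1 / 2))
      ?_ (fun i => Metric.isOpen_ball) (fun i => ⟨i, Metric.mem_ball_self (by norm_num)⟩)
    intro i j hij
    refine Metric.ball_disjoint_ball ?_
    have h1 : ‖(i : Vᗮ) - j‖ ^ 2 = 2 := by
      rw [norm_sub_sq_real, hwon.1 i, hwon.1 j, hwon.2 hij]
      norm_num
    rw [dist_eq_norm]
    nlinarith [norm_nonneg ((i : Vᗮ) - j)]
  have hwi : Infinite w := by
    by_contra hfw
    rw [not_infinite_iff_finite] at hfw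
    have := Fintype.ofFinite w
    have : FiniteDimensional ℝ Vᗮ := b.toOrthonormalBasis.toBasis.finiteDimensional_of_finite
    have h1 : FiniteDimensional ℝ (V ⊔ Vᗮ : Submodule ℝ H) := inferInstance
    rw [Submodule.sup_orthogonal_of_hasOrthogonalProjection] at h1
    exact hH (Module.finite_def.2 (Module.Finite.iff_fg.1 h1))
  obtain ⟨q⟩ := nonempty_equiv_of_countable (α := ℕ) (β := w)
  let g : ℕ → H := fun j => if h : j < n then (v ⟨j, h⟩ : H) else ((b (q (j - n)) : Vᗮ) : H)
  have hg : Orthonormal ℝ g := by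
    refine ⟨fun j => ?_, fun i j hij => ?_⟩
    · by_cases hj : j < n
      · simp only [g, hj, dif_pos]
        exact v.orthonormal.1 _
      · simp only [g, hj, dif_neg, not_false_eq_true]
        exact b.orthonormal.1 _
    · by_cases hi : i < n <;> by_cases hj : j < n
      · simp only [g, hi, hj, dif_pos]
        exact v.orthonormal.2 (fun h => hij (congrArg Fin.val h))
      · simp only [g, hi, hj, dif_pos, dif_neg, not_false_eq_true]
        exact Submodule.inner_right_of_mem_orthogonal (v ⟨i, hi⟩).2 (b (q (j - n))).2
      · simp only [g, hi, hj, dif_pos, dif_neg, not_false_eq_true]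
        exact Submodule.inner_left_of_mem_orthogonal (v ⟨j, hj⟩).2 (b (q (i - n))).2
      · simp only [g, hi, hj, dif_neg, not_false_eq_true]
        refine b.orthonormal.2 (fun h => ?_)
        have := q.injective h
        omega
  have hsp : (Submodule.span ℝ (Set.range g))ᗮ = ⊥ := by
    rw [Submodule.eq_bot_iff]
    intro y hy
    have hyg : ∀ j, ⟪g j, y⟫_ℝ = 0 := fun j => hy _ (Submodule.subset_span ⟨j, rfl⟩)
    have hyV : y ∈ Vᗮ := by
      intro a ha
      have h1 := v.sum_repr ⟨a, ha⟩
      have h2 : a = ∑ i, v.repr ⟨a, ha⟩ i • (v i : H) := by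
        have := congrArg Subtype.val h1
        simpa using this.symm
      rw [h2, sum_inner]
      refine Finset.sum_eq_zero fun i _ => ?_
      have h3 := hyg i
      simp only [g, i.2, dif_pos] at h3
      rw [inner_smul_left, h3, mul_zero]
    have h0 : (⟨y, hyV⟩ : Vᗮ) = 0 := by
      have h1 := b.hasSum_inner_mul_inner ⟨y, hyV⟩ ⟨y, hyV⟩
      have h2 : ∀ k, ⟪b k, (⟨y, hyV⟩ : Vᗮ)⟫_ℝ = 0 := by
        intro k
        have h3 := hyg (n + q.symm k)
        simpa [g] using h3
      simp only [h2, mul_zero] at h1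
      exact inner_self_eq_zero.1 (h1.unique hasSum_zero)
    exact congrArg Subtype.val h0
  refine ⟨fun j => if h : j < n then lam ⟨j, h⟩ else 0, HilbertBasis.mkOfOrthogonalEqBot hg hsp,
    ?_, ?_⟩
  · intro i j hij
    by_cases hj : j < n
    · have hi : i < n := lt_of_le_of_lt hij hj
      simp only [hi, hj, dif_pos]
      exact hT.eigenvalues_antitone hn.symm hij
    · by_cases hi : i < n
      · simp only [hi, hj, dif_pos, dif_neg, not_false_eq_true]
        exact hlam0 _
      · simp [hi, hj]
  · intro j
    rw [HilbertBasis.coe_mkOfOrthogonalEqBot]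
    by_cases hj : j < n
    · simp only [g, hj, dif_pos]
      exact heig _
    · simp only [g, hj, dif_neg, not_false_eq_true, zero_smul]
      have h1 := (b (q (j - n))).2
      have h2 := h1 (S (S (b (q (j - n)) : H))) ⟨_, rfl⟩
      have h3 := hsym (S (b (q (j - n)) : H)) (b (q (j - n)) : H)
      simp only [ContinuousLinearMap.coe_coe] at h3
      rw [h3] at h2
      exact inner_self_eq_zero.1 h2

/-! ### The estimator -/

/-- The functional IV estimator built from the sample operators `Cyz`, `Cxz`, the threshold `a`,
and the eigenelements `ev`, `e` of `Cxz* Cxz`. -/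
def estimator (Cyz Cxz : H →L[ℝ] H) (a : ℝ) (ev : ℕ → ℝ) (e : ℕ → H) : H →L[ℝ] H :=
  (adj Cyz).comp (Cxz.comp (regInverse a ev e))

/-- Singular value decomposition of `C`: `fⱼ` and `xiⱼ` are the eigenvectors of `C* C` and `C C*`
for the eigenvalues `lamⱼ²`, both form orthonormal bases, and they are matched by
`C fⱼ = lamⱼ xiⱼ`. -/
structure IsSingularSystem (C : H →L[ℝ] H) (lam : ℕ → ℝ) (f xi : HilbertBasis ℕ ℝ H) : Prop where
  eigen_f : IsEigenSystem ((adj C).comp C) (fun j => lam j ^ 2) f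
  eigen_xi : IsEigenSystem (C.comp (adj C)) (fun j => lam j ^ 2) xi
  map_f : ∀ j, C (f j) = lam j • xi j
  map_xi : ∀ j, adj C (xi j) = lam j • f j

end Operators

section Probability

variable {Ω : Type*} [mΩ : MeasurableSpace Ω]

/-! ### Stochastic orders of `[0, ∞]`-valued sequences -/

/-- `X T = O_p(r T)` as `T → ∞`. -/
def IsBigOp (μ : Measure Ω) (X : ℕ → Ω → ℝ≥0∞) (r : ℕ → ℝ) : Prop :=
  ∀ ε : ℝ, 0 < ε → ∃ M : ℝ, 0 < M ∧
    ∀ᶠ T in atTop, μ {ω | ENNReal.ofReal (M * r T) < X T ω} ≤ ENNReal.ofReal ε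

/-- `X T = o_p(1)` as `T → ∞`. -/
def IsLittleOpOne (μ : Measure Ω) (X : ℕ → Ω → ℝ≥0∞) : Prop :=
  ∀ ε : ℝ, 0 < ε → Tendsto (fun T => μ {ω | ENNReal.ofReal ε < X T ω}) atTop (𝓝 0)

/-! ### Dependence -/

/-- Strict stationarity: all time shifts of the process have the same law as the process. -/
def IsStationary {E : Type*} [MeasurableSpace E] (μ : Measure Ω) (w : ℕ → Ω → E) : Prop :=
  ∀ k, μ.map (fun ω t => w (t + k) ω) = μ.map (fun ω t => w t ω)

/-- Geometric strong mixing: the strong mixing coefficients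
`sup_t sup {|P(A ∩ B) - P(A) P(B)| : A ∈ σ(w_s, s ≤ t), B ∈ σ(w_s, s ≥ t + k)}` decay
geometrically in the lag `k`. -/
def IsGeometricallyStrongMixing {E : Type*} [mE : MeasurableSpace E] (μ : Measure Ω)
    (w : ℕ → Ω → E) : Prop :=
  ∃ c r : ℝ, 0 < c ∧ 0 < r ∧ r < 1 ∧ ∀ (t k : ℕ) (A B : Set Ω),
    MeasurableSet[⨆ s, ⨆ _ : s ≤ t, mE.comap (w s)] A →
    MeasurableSet[⨆ s, ⨆ _ : t + k ≤ s, mE.comap (w s)] B →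
    |μ.real (A ∩ B) - μ.real A * μ.real B| ≤ c * r ^ k

/-- `Y` is a version of the conditional expectation given `m` of the `[0, ∞]`-valued variable `g`,
which need not be integrable. -/
structure IsCondMean (μ : Measure Ω) (m : MeasurableSpace Ω) (g Y : Ω → ℝ≥0∞) : Prop where
  measurable : Measurable[m] Y
  lintegral_eq : ∀ B, MeasurableSet[m] B → ∫⁻ ω in B, Y ω ∂μ = ∫⁻ ω in B, g ω ∂μ

variable {H : Type*} [NormedAddCommGroup H] [InnerProductSpace ℝ H]

/-- The sigma-algebra `σ({z_s}_{s ≤ t}, {u_s}_{s < t})`, which contains the information available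
before the error `u_t` is realized. -/
abbrev pastInfo [mH : MeasurableSpace H] (z u : ℕ → Ω → H) (t : ℕ) : MeasurableSpace Ω :=
  (⨆ s, ⨆ _ : s ≤ t, mH.comap (z s)) ⊔ (⨆ s, ⨆ _ : s < t, mH.comap (u s))

/-! ### Population and sample operators -/

/-- The operator `E[X ⊗ Y]`. -/
def popOp (μ : Measure Ω) (X Y : Ω → H) : H →L[ℝ] H := ∫ ω, tensor (X ω) (Y ω) ∂μ

/-- The sample operator `T⁻¹ ∑_{t ≤ T} X_t ⊗ Y_t`. -/
def sampleOp (X Y : ℕ → Ω → H) (T : ℕ) (ω : Ω) : H →L[ℝ] H :=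
  (T : ℝ)⁻¹ • ∑ t ∈ Finset.range T, tensor (X t ω) (Y t ω)

/-- The eigenelements entering the definition of the estimator exist for all data. -/
theorem exists_isEigenSystem_sampleOp [CompleteSpace H] [TopologicalSpace.SeparableSpace H]
    (hH : ¬ FiniteDimensional ℝ H) (X Y : ℕ → Ω → H) (T : ℕ) (ω : Ω) :
    ∃ (ev : ℕ → ℝ) (e : HilbertBasis ℕ ℝ H),
      IsEigenSystem ((adj (sampleOp X Y T ω)).comp (sampleOp X Y T ω)) ev e := by
  refine exists_isEigenSystem hH _ (ContinuousLinearMap.isPositive_adjoint_comp_self _) ?_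
  set C := sampleOp X Y T ω with hC
  have h1 : C.toLinearMap.range ≤
      Submodule.span ℝ ((fun t => Y t ω) '' (Finset.range T : Set ℕ)) := by
    rintro _ ⟨v, rfl⟩
    simp only [hC, sampleOp, ContinuousLinearMap.coe_coe, smul_apply, sum_apply,
      tensor_apply]
    refine Submodule.smul_mem _ _ (Submodule.sum_mem _ fun t ht => Submodule.smul_mem _ _ ?_)
    exact Submodule.subset_span ⟨t, ht, rfl⟩
  have : FiniteDimensional ℝ
      (Submodule.span ℝ ((fun t => Y t ω) '' (Finset.range T : Set ℕ))) :=
    FiniteDimensional.span_of_finite ℝ ((Finset.finite_toSet _).image _)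
  have : FiniteDimensional ℝ C.toLinearMap.range := Submodule.finiteDimensional_of_le h1
  have h2 : ((adj C).comp C).toLinearMap.range
      = C.toLinearMap.range.map (adj C).toLinearMap :=
    LinearMap.range_comp _ _
  rw [h2]
  infer_instance

/-! ### Assumptions -/

/-- `⟪x_t, f_j⟫ ⟪z_t, xi_l⟫ - E[⟪x_t, f_j⟫ ⟪z_t, xi_l⟫]`. -/
def upsilon (μ : Measure Ω) (x z : ℕ → Ω → H) (f xi : ℕ → H) (t j l : ℕ) (ω : Ω) : ℝ :=
  ⟪x t ω, f j⟫_ℝ * ⟪z t ω, xi l⟫_ℝ - ∫ ω', ⟪x t ω', f j⟫_ℝ * ⟪z t ω', xi l⟫_ℝ ∂μ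

variable [CompleteSpace H] [MeasurableSpace H]

/-- The functional endogenous linear model `y_t = A x_t + u_t` with instrument `z_t`. -/
structure IsModel (μ : Measure Ω) (A : H →L[ℝ] H) (x y z u : ℕ → Ω → H) : Prop where
  measurable_x : ∀ t, Measurable (x t)
  measurable_y : ∀ t, Measurable (y t)
  measurable_z : ∀ t, Measurable (z t)
  measurable_u : ∀ t, Measurable (u t)
  model : ∀ t, ∀ᵐ ω ∂μ, y t ω = A (x t ω) + u t ω
  mean_x : ∀ t, ∫ ω, x t ω ∂μ = 0
  mean_z : ∀ t, ∫ ω, z t ω ∂μ = 0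
  mean_u : ∀ t, ∫ ω, u t ω ∂μ = 0
  endogenous : ∀ t, popOp μ (x t) (u t) ≠ 0
  relevant : ∀ t, popOp μ (x t) (z t) ≠ 0
  valid : ∀ t, popOp μ (u t) (z t) = 0

/-- The general assumptions; `lam j ^ 2` are the eigenvalues of `Cxz* Cxz`. -/
structure BaseAssumption (μ : Measure Ω) (A : H →L[ℝ] H) (x y z u : ℕ → Ω → H)
    (lam : ℕ → ℝ) : Prop where
  isModel : IsModel μ A x y z u
  stationary : IsStationary μ (fun t ω => (x t ω, z t ω))
  mixing : IsGeometricallyStrongMixing μ (fun t ω => (x t ω, z t ω))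
  memLp_x : ∀ t, MemLp (x t) 2 μ
  memLp_z : ∀ t, MemLp (z t) 2 μ
  memLp_u : ∀ t, MemLp (u t) 2 μ
  condExp_u : ∀ t, μ[u t | pastInfo z u t] =ᵐ[μ] 0
  condExp_uu : ∀ t, μ[fun ω => tensor (u t ω) (u t ω) | pastInfo z u t]
    =ᵐ[μ] fun _ => popOp μ (u 0) (u 0)
  condMoment_u : ∃ δ : ℝ, 0 < δ ∧ ∃ Y : ℕ → Ω → ℝ≥0∞,
    (∀ t, IsCondMean μ (pastInfo z u t) (fun ω => ‖u t ω‖ₑ ^ (2 + δ)) (Y t)) ∧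
    ∀ T : ℕ, ∀ᵐ ω ∂μ, (⨆ t, ⨆ _ : t < T, Y t ω) < ∞
  ker_eq_bot : ((adj (popOp μ (x 0) (z 0))).comp (popOp μ (x 0) (z 0))).toLinearMap.ker = ⊥
  hilbertSchmidt : hsNorm A < ∞
  strictAnti : StrictAnti (fun j => lam j ^ 2)
  pos : ∀ j, 0 < lam j ^ 2
  rate_xz : IsBigOp μ (fun T ω => hsNorm (sampleOp x z T ω - popOp μ (x 0) (z 0)))
    (fun T => (T : ℝ) ^ (-(1 / 2) : ℝ))
  rate_zz : IsBigOp μ (fun T ω => hsNorm (sampleOp z z T ω - popOp μ (z 0) (z 0)))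
    (fun T => (T : ℝ) ^ (-(1 / 2) : ℝ))
  rate_uz : IsBigOp μ (fun T ω => hsNorm (sampleOp u z T ω - popOp μ (u 0) (z 0)))
    (fun T => (T : ℝ) ^ (-(1 / 2) : ℝ))
  consistent_uu :
    IsLittleOpOne μ (fun T ω => hsNorm (sampleOp u u T ω - popOp μ (u 0) (u 0)))

/-- The additional assumptions on the decay of the eigenvalues, on the smoothness of `A`, and on
the dependence of the products of scores. -/
structure RateAssumption (μ : Measure Ω) (A : H →L[ℝ] H) (x y z u : ℕ → Ω → H)
    (lam : ℕ → ℝ) (f xi : ℕ → H) (c ρ ς γ m : ℝ) : Prop where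
  base : BaseAssumption μ A x y z u lam
  c_pos : 0 < c
  two_lt_ρ : 2 < ρ
  half_lt_ς : 1 / 2 < ς
  half_lt_γ : 1 / 2 < γ
  one_lt_m : 1 < m
  eigenvalue_le : ∀ j : ℕ, lam j ^ 2 ≤ c * ((j : ℝ) + 1) ^ (-ρ)
  gap_le : ∀ j : ℕ, c⁻¹ * ((j : ℝ) + 1) ^ (-ρ - 1) ≤ lam j ^ 2 - lam (j + 1) ^ 2
  smooth : ∀ j l : ℕ,
    |⟪A (f j), xi l⟫_ℝ| ≤ c * ((j : ℝ) + 1) ^ (-ς) * ((l : ℝ) + 1) ^ (-γ)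
  autocov : ∀ t s j l : ℕ, 1 ≤ s →
    ∫ ω, upsilon μ x z f xi (t + s) j l ω * upsilon μ x z f xi t j l ω ∂μ
      ≤ c * (s : ℝ) ^ (-m) * ∫ ω, upsilon μ x z f xi (t + s) j l ω ^ 2 ∂μ
  moment_x : ∀ t j : ℕ,
    ∫⁻ ω, ‖⟪x t ω, f j⟫_ℝ • z t ω‖ₑ ^ 2 ∂μ ≤ ENNReal.ofReal (c * |lam j|)
  moment_z : ∀ t j : ℕ,
    ∫⁻ ω, ‖⟪z t ω, xi j⟫_ℝ • x t ω‖ₑ ^ 2 ∂μ ≤ ENNReal.ofReal (c * |lam j|)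

end Probability

end

end FIVE

namespace FIVE

/-! ### Eigenvalue perturbation and spectral projections -/

section Operators

variable {H : Type*} [NormedAddCommGroup H] [InnerProductSpace ℝ H]

/-! Write `C'` for the sample operator of (x, z), `C` for its population version, `D = C' - C`, and
`P` for the projection onto the leading eigenvectors of `C'* C'`.

Variance. The model equation turns the estimator minus `A P` into the adjoint of the sample operator
of (u, z), composed with `C'` times the regularized inverse. The first factor is of order T^(-1/2)
because E[u ⊗ z] = 0. The second has squared norm at most 1/α, since only eigenvalues above α are
inverted.

Bias. Expanding in the population basis, ‖A(I - P)‖ is at most the sum over j < K of ‖(I - P) f_j‖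
‖A f_j‖, plus the square root of the sum of ‖A f_j‖² over j ≥ K. No sample eigenvector has to be
matched with a population one: only the distance of f_j from the leading sample space enters, and
`gap_mul_norm_sub_truncProj_le` bounds it by |λ_j| (‖D f_j‖ + ‖D* ξ_j‖) divided by λ_j² minus the
first discarded sample eigenvalue. By Weyl's inequality this denominator is at least of order
j^(-ρ-1): the rate of α makes the perturbation smaller than half of the gap bound at each retained
index. The squares of the D-terms sum to at most 4‖D‖² in Hilbert-Schmidt norm, so Cauchy-Schwarz
leaves the sum of j^(ρ+2-2ς) over j ≤ K, with K^ρ of order at most 1/α. The tail is of order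
(K+1)^(1-2ς), and (K+1)^(-ρ) is of order at most α. All this is deterministic
(`norm_sq_comp_sub_truncProj_le`); probability enters only through the assumed rates of the sample
operators.

Consistency follows by adding the two errors, as both rates tend to 0. -/

theorem hasSum_sq_inner {ι : Type*} (e : HilbertBasis ι ℝ H) (v : H) :
    HasSum (fun j => ⟪e j, v⟫_ℝ ^ 2) (‖v‖ ^ 2) := by
  have h := e.hasSum_inner_mul_inner v v
  rw [real_inner_self_eq_norm_sq] at h
  refine h.congr_fun fun j => ?_
  rw [real_inner_comm v (e j), sq]

theorem hasSum_inner_smul {ι : Type*} (e : HilbertBasis ι ℝ H) (A : H →L[ℝ] H) (v : H) :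
    HasSum (fun j => ⟪e j, v⟫_ℝ • A (e j)) (A v) := by
  have h := (e.hasSum_repr v).mapL A
  refine h.congr_fun fun j => ?_
  rw [map_smul, e.repr_apply_apply]

namespace IsEigenSystem

variable {S S' : H →L[ℝ] H} {ev ev' : ℕ → ℝ} {e e' : HilbertBasis ℕ ℝ H}

theorem hasSum_inner (h : IsEigenSystem S ev e) (v : H) :
    HasSum (fun j => ev j * ⟪e j, v⟫_ℝ ^ 2) ⟪v, S v⟫_ℝ := by
  have h1 := (hasSum_inner_smul e S v).mapL (innerSL ℝ v)
  refine h1.congr_fun fun j => ?_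
  rw [h.apply_eq, innerSL_apply_apply, inner_smul_right, inner_smul_right,
    real_inner_comm (e j) v]
  ring

theorem inner_le (h : IsEigenSystem S ev e) {k : ℕ} {v : H}
    (hv : ∀ j < k, ⟪e j, v⟫_ℝ = 0) : ⟪v, S v⟫_ℝ ≤ ev k * ‖v‖ ^ 2 := by
  refine hasSum_le (fun j => ?_) (h.hasSum_inner v) ((hasSum_sq_inner e v).mul_left (ev k))
  rcases lt_or_ge j k with hj | hj
  · simp [hv j hj]
  · exact mul_le_mul_of_nonneg_right (h.antitone hj) (sq_nonneg _)

theorem le_inner (h : IsEigenSystem S ev e) {k : ℕ} {v : H}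
    (hv : ∀ j, k < j → ⟪e j, v⟫_ℝ = 0) : ev k * ‖v‖ ^ 2 ≤ ⟪v, S v⟫_ℝ := by
  refine hasSum_le (fun j => ?_) ((hasSum_sq_inner e v).mul_left (ev k)) (h.hasSum_inner v)
  rcases lt_or_ge k j with hj | hj
  · simp [hv j hj]
  · exact mul_le_mul_of_nonneg_right (h.antitone hj) (sq_nonneg _)

/-- Weyl's inequality. -/
theorem eigenvalue_le_add_norm_sub (h : IsEigenSystem S ev e) (h' : IsEigenSystem S' ev' e')
    (k : ℕ) : ev k ≤ ev' k + ‖S - S'‖ := by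
  let φ : (Fin (k + 1) → ℝ) →ₗ[ℝ] H := Fintype.linearCombination ℝ (fun i : Fin (k + 1) => e i)
  let ψ : H →ₗ[ℝ] (Fin k → ℝ) :=
    LinearMap.pi fun i : Fin k => (innerSL ℝ (e' i)).toLinearMap
  -- Dimension count: the span of the first k + 1 vectors `e i` contains a nonzero vector orthogonal
  -- to the first k vectors `e' i`. The two quadratic forms are compared on it.
  have hker : (ψ ∘ₗ φ).ker ≠ ⊥ := LinearMap.ker_ne_bot_of_finrank_lt (by simp)
  obtain ⟨w, hw, hw0⟩ := Submodule.exists_mem_ne_zero_of_ne_bot hker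
  have hlin : LinearIndependent ℝ (fun i : Fin (k + 1) => e i) :=
    (e.orthonormal.comp _ Fin.val_injective).linearIndependent
  set v := φ w with hv
  have hv0 : v ≠ 0 := by
    intro h0
    exact hw0 (hlin.fintypeLinearCombination_injective (by rw [map_zero]; exact h0))
  have hv' : ∀ j < k, ⟪e' j, v⟫_ℝ = 0 := fun j hj => congrFun hw ⟨j, hj⟩
  have hve : ∀ j, k < j → ⟪e j, v⟫_ℝ = 0 := by
    intro j hj
    rw [hv, Fintype.linearCombination_apply, inner_sum]
    refine Finset.sum_eq_zero fun i _ => ?_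
    rw [inner_smul_right, e.orthonormal.2 (by omega), mul_zero]
  have h1 := h.le_inner hve
  have h2 := h'.inner_le hv'
  have h3 : ⟪v, (S - S') v⟫_ℝ ≤ ‖S - S'‖ * ‖v‖ ^ 2 := by
    refine (real_inner_le_norm _ _).trans ?_
    nlinarith [(S - S').le_opNorm v, norm_nonneg v]
  rw [sub_apply, inner_sub_right] at h3
  have hpos : 0 < ‖v‖ ^ 2 := by positivity
  exact le_of_mul_le_mul_right (by linarith) hpos

end IsEigenSystem

theorem lt_of_lt_truncIndex {a : ℝ} {ev : ℕ → ℝ} (hev : Antitone ev) {j : ℕ}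
    (hj : j < truncIndex a ev) : a < ev j := by
  by_contra hcon
  have hsub : {i | a < ev i} ⊆ (Finset.range j : Set ℕ) := by
    intro i hi
    rw [Finset.coe_range, Set.mem_Iio]
    by_contra hij
    exact hcon (lt_of_lt_of_le hi (hev (not_lt.1 hij)))
  have := Set.ncard_le_ncard hsub (Finset.finite_toSet _)
  rw [Set.ncard_coe_finset, Finset.card_range] at this
  exact absurd hj (not_lt.2 this)

/-- Finiteness matters: `Set.ncard` of an infinite set is 0, so `truncIndex` would then be 0. -/
theorem le_of_truncIndex_le {a : ℝ} {ev : ℕ → ℝ} (hev : Antitone ev)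
    (hfin : {j | a < ev j}.Finite) {j : ℕ} (hj : truncIndex a ev ≤ j) : ev j ≤ a := by
  by_contra hcon
  rw [not_le] at hcon
  have hsub : (Finset.range (j + 1) : Set ℕ) ⊆ {i | a < ev i} := by
    intro i hi
    rw [Finset.coe_range, Set.mem_Iio] at hi
    exact lt_of_lt_of_le hcon (hev (by omega))
  have := Set.ncard_le_ncard hsub hfin
  rw [Set.ncard_coe_finset, Finset.card_range] at this
  exact absurd hj (by rw [truncIndex]; omega)

theorem truncProj_apply (a : ℝ) (ev : ℕ → ℝ) (e : ℕ → H) (v : H) :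
    truncProj a ev e v = ∑ j ∈ Finset.range (truncIndex a ev), ⟪e j, v⟫_ℝ • e j := by
  simp [truncProj, sum_apply, tensor_apply]

theorem inner_sum_inner_smul {e : ℕ → H} (he : Orthonormal ℝ e) (n : ℕ) (v : H) {i : ℕ}
    (hi : i < n) : ⟪e i, v - ∑ j ∈ Finset.range n, ⟪e j, v⟫_ℝ • e j⟫_ℝ = 0 := by
  rw [inner_sub_right, inner_sum, Finset.sum_eq_single i, inner_smul_right,
    real_inner_self_eq_norm_sq, he.1 i]
  · ring
  · intro j _ hj
    rw [inner_smul_right, he.2 hj.symm, mul_zero]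
  · intro h
    exact absurd (Finset.mem_range.2 hi) h

theorem inner_sub_truncProj_eq_zero (a : ℝ) (ev : ℕ → ℝ) {e : ℕ → H} (he : Orthonormal ℝ e)
    (v : H) {i : ℕ} (hi : i < truncIndex a ev) : ⟪e i, v - truncProj a ev e v⟫_ℝ = 0 := by
  rw [truncProj_apply]
  exact inner_sum_inner_smul he _ v hi

theorem inner_truncProj_comm (a : ℝ) (ev : ℕ → ℝ) (e : ℕ → H) (v w : H) :
    ⟪truncProj a ev e v, w⟫_ℝ = ⟪v, truncProj a ev e w⟫_ℝ := by
  simp only [truncProj_apply, sum_inner, inner_sum, inner_smul_left, inner_smul_right]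
  refine Finset.sum_congr rfl fun j _ => ?_
  simp only [conj_trivial, real_inner_comm v (e j)]
  ring

theorem inner_truncProj_sub_truncProj (a : ℝ) (ev : ℕ → ℝ) {e : ℕ → H} (he : Orthonormal ℝ e)
    (v w : H) : ⟪truncProj a ev e v, w - truncProj a ev e w⟫_ℝ = 0 := by
  rw [truncProj_apply a ev e v, sum_inner]
  refine Finset.sum_eq_zero fun j hj => ?_
  rw [inner_smul_left, inner_sub_truncProj_eq_zero a ev he w (Finset.mem_range.1 hj), mul_zero]

theorem inner_sub_truncProj_self (a : ℝ) (ev : ℕ → ℝ) {e : ℕ → H} (he : Orthonormal ℝ e)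
    (v : H) : ⟪v, v - truncProj a ev e v⟫_ℝ = ‖v - truncProj a ev e v‖ ^ 2 := by
  have h := inner_truncProj_sub_truncProj a ev he v v
  rw [← real_inner_self_eq_norm_sq, inner_sub_left v, h, sub_zero]

theorem norm_sub_truncProj_le (a : ℝ) (ev : ℕ → ℝ) {e : ℕ → H} (he : Orthonormal ℝ e)
    (v : H) : ‖v - truncProj a ev e v‖ ≤ ‖v‖ := by
  have h := inner_sub_truncProj_self a ev he v
  have h1 := real_inner_le_norm v (v - truncProj a ev e v)
  by_contra hcon
  nlinarith [norm_nonneg v, norm_nonneg (v - truncProj a ev e v)]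

theorem norm_sub_sum_inner_smul_le {e : ℕ → H} (he : Orthonormal ℝ e) (n : ℕ) (v : H) :
    ‖v - ∑ j ∈ Finset.range n, ⟪e j, v⟫_ℝ • e j‖ ≤ ‖v‖ := by
  set w := ∑ j ∈ Finset.range n, ⟪e j, v⟫_ℝ • e j with hw
  have h : ⟪w, v - w⟫_ℝ = 0 := by
    rw [hw, sum_inner]
    refine Finset.sum_eq_zero fun j hj => ?_
    rw [inner_smul_left, inner_sum_inner_smul he n v (Finset.mem_range.1 hj), mul_zero]
  have h2 : ‖v‖ ^ 2 = ‖w‖ ^ 2 + ‖v - w‖ ^ 2 := by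
    have := norm_add_sq_real w (v - w)
    rw [h, add_sub_cancel] at this
    linarith
  exact le_of_sq_le_sq (by nlinarith [sq_nonneg ‖w‖]) (norm_nonneg _)

/-- The span of the leading eigenvectors is invariant under `S`, so the cross term vanishes. -/
theorem IsEigenSystem.inner_map_sub_truncProj {S : H →L[ℝ] H} {ev : ℕ → ℝ}
    {e : HilbertBasis ℕ ℝ H} (h : IsEigenSystem S ev e) (a : ℝ) (v : H) :
    ⟪S v, v - truncProj a ev e v⟫_ℝ
      = ⟪S (v - truncProj a ev e v), v - truncProj a ev e v⟫_ℝ := by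
  have h0 : ⟪S (truncProj a ev e v), v - truncProj a ev e v⟫_ℝ = 0 := by
    rw [truncProj_apply a ev e v, map_sum, sum_inner]
    refine Finset.sum_eq_zero fun j hj => ?_
    have := inner_sub_truncProj_eq_zero a ev e.orthonormal v (Finset.mem_range.1 hj)
    rw [truncProj_apply] at this
    rw [map_smul, h.apply_eq, inner_smul_left, inner_smul_left, this, mul_zero, mul_zero]
  rw [map_sub, inner_sub_left, h0, sub_zero]

/-- Cauchy-Schwarz bound for an operator on vectors that are orthogonal to the first `n` elements
of a basis. -/
theorem norm_map_le_of_sum_sq_le (e : HilbertBasis ℕ ℝ H) (A : H →L[ℝ] H) {n : ℕ} {B : ℝ}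
    (hB : 0 ≤ B) (hA : ∀ s : Finset ℕ, (∀ j ∈ s, n ≤ j) → ∑ j ∈ s, ‖A (e j)‖ ^ 2 ≤ B ^ 2)
    {v : H} (hv : ∀ j < n, ⟪e j, v⟫_ℝ = 0) : ‖A v‖ ≤ B * ‖v‖ := by
  classical
  refine le_of_tendsto (hasSum_inner_smul e A v).norm (Eventually.of_forall fun s => ?_)
  have h1 : ∑ j ∈ s, ⟪e j, v⟫_ℝ • A (e j)
      = ∑ j ∈ s.filter (n ≤ ·), ⟪e j, v⟫_ℝ • A (e j) := by
    symm
    refine Finset.sum_subset (Finset.filter_subset _ _) fun j hj hj' => ?_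
    rw [hv j (by simpa [hj] using hj'), zero_smul]
  rw [h1]
  set t := s.filter (n ≤ ·) with ht
  have h2 : ‖∑ j ∈ t, ⟪e j, v⟫_ℝ • A (e j)‖ ≤ ∑ j ∈ t, |⟪e j, v⟫_ℝ| * ‖A (e j)‖ :=
    (norm_sum_le _ _).trans_eq (Finset.sum_congr rfl fun j _ => by
      rw [norm_smul, Real.norm_eq_abs])
  have h3 := Finset.sum_mul_sq_le_sq_mul_sq t (fun j => |⟪e j, v⟫_ℝ|) (fun j => ‖A (e j)‖)
  have h4 : ∑ j ∈ t, |⟪e j, v⟫_ℝ| ^ 2 ≤ ‖v‖ ^ 2 := by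
    simp only [sq_abs]
    exact sum_le_hasSum t (fun _ _ => sq_nonneg _) (hasSum_sq_inner e v)
  have h5 := hA t (fun j hj => (Finset.mem_filter.1 hj).2)
  refine h2.trans (le_of_sq_le_sq (h3.trans ?_) (by positivity))
  rw [mul_pow, mul_comm]
  exact mul_le_mul h5 h4 (Finset.sum_nonneg fun _ _ => sq_nonneg _) (sq_nonneg _)

variable [CompleteSpace H]

theorem sum_sq_norm_le_of_hsNorm_le {ι : Type*} (e : HilbertBasis ι ℝ H) {D : H →L[ℝ] H} {b : ℝ}
    (hb : 0 ≤ b) (hD : hsNorm D ≤ ENNReal.ofReal b) (s : Finset ι) :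
    ∑ j ∈ s, ‖D (e j)‖ ^ 2 ≤ b ^ 2 := by
  rw [hsNorm_eq e, ← ENNReal.le_rpow_inv_iff (by norm_num)] at hD
  rw [← ENNReal.ofReal_le_ofReal_iff (sq_nonneg _), ENNReal.ofReal_sum_of_nonneg
    (fun _ _ => sq_nonneg _)]
  have h1 : ∑ j ∈ s, ENNReal.ofReal (‖D (e j)‖ ^ 2) = ∑ j ∈ s, ‖D (e j)‖ₑ ^ 2 :=
    Finset.sum_congr rfl fun j _ => by
      rw [ENNReal.ofReal_pow (norm_nonneg _), ofReal_norm]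
  rw [h1]
  refine (ENNReal.sum_le_tsum s).trans (hD.trans_eq ?_)
  rw [ENNReal.ofReal_pow hb, one_div, inv_inv]
  norm_cast

theorem sum_sq_norm_adj_le_of_hsNorm_le {ι : Type*} (e : HilbertBasis ι ℝ H) {D : H →L[ℝ] H}
    {b : ℝ} (hb : 0 ≤ b) (hD : hsNorm D ≤ ENNReal.ofReal b) (s : Finset ι) :
    ∑ j ∈ s, ‖adj D (e j)‖ ^ 2 ≤ b ^ 2 := by
  refine sum_sq_norm_le_of_hsNorm_le e hb (le_of_eq_of_le ?_ hD) s
  rw [hsNorm_eq e D, hsNorm_eq e, tsum_sq_swap e e D]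

theorem norm_le_of_hsNorm_le (e : HilbertBasis ℕ ℝ H) {D : H →L[ℝ] H} {b : ℝ} (hb : 0 ≤ b)
    (hD : hsNorm D ≤ ENNReal.ofReal b) : ‖D‖ ≤ b :=
  D.opNorm_le_bound hb fun _ => norm_map_le_of_sum_sq_le e D (n := 0) hb
    (fun s _ => sum_sq_norm_le_of_hsNorm_le e hb hD s) (fun _ h => absurd h (Nat.not_lt_zero _))

theorem norm_adj_comp_self_sub_le (C C' : H →L[ℝ] H) :
    ‖(adj C').comp C' - (adj C).comp C‖ ≤ ‖C' - C‖ * (2 * ‖C‖ + ‖C' - C‖) := by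
  have h : (adj C').comp C' - (adj C).comp C
      = (adj C').comp (C' - C) + (adj (C' - C)).comp C := by
    ext v
    simp [adj]
  have h1 : ‖adj C'‖ ≤ ‖C‖ + ‖C' - C‖ := by
    rw [LinearIsometryEquiv.norm_map]
    exact norm_le_norm_add_norm_sub' _ _
  have h2 : ‖adj (C' - C)‖ = ‖C' - C‖ := LinearIsometryEquiv.norm_map _ _
  rw [h]
  refine (norm_add_le _ _).trans ((add_le_add (ContinuousLinearMap.opNorm_comp_le _ _)
    (ContinuousLinearMap.opNorm_comp_le _ _)).trans ?_)
  rw [h2]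
  nlinarith [norm_nonneg (C' - C)]

/-- How far a population singular vector is from the span of the leading sample eigenvectors. -/
theorem gap_mul_norm_sub_truncProj_le {C C' : H →L[ℝ] H} {lam : ℕ → ℝ}
    {f xi : HilbertBasis ℕ ℝ H} (hC : IsSingularSystem C lam f xi) {ev : ℕ → ℝ}
    {e : HilbertBasis ℕ ℝ H} (h' : IsEigenSystem ((adj C').comp C') ev e) {a : ℝ} {j : ℕ}
    (hj : ev (truncIndex a ev) ≤ lam j ^ 2) :
    (lam j ^ 2 - ev (truncIndex a ev)) * ‖f j - truncProj a ev e (f j)‖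
      ≤ |lam j| * (‖(C' - C) (f j)‖ + ‖adj (C' - C) (xi j)‖) := by
  set p := f j - truncProj a ev e (f j) with hp
  have h1 := h'.inner_map_sub_truncProj a (f j)
  rw [← hp] at h1
  have h2 : ⟪p, (adj C').comp C' p⟫_ℝ ≤ ev (truncIndex a ev) * ‖p‖ ^ 2 :=
    h'.inner_le fun i hi => inner_sub_truncProj_eq_zero a ev e.orthonormal _ hi
  have h3 : ⟪p, (adj C').comp C' p⟫_ℝ = ‖C' p‖ ^ 2 := by
    rw [ContinuousLinearMap.comp_apply, ContinuousLinearMap.adjoint_inner_right,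
      real_inner_self_eq_norm_sq]
  -- Since `p` lies in the trailing sample eigenspace, `C'` shrinks it; this is what puts the factor
  -- |λ_j| in front of both error terms.
  have h4 : ‖C' p‖ ≤ |lam j| * ‖p‖ := by
    refine le_of_sq_le_sq ?_ (by positivity)
    rw [mul_pow, sq_abs, ← h3]
    exact h2.trans (mul_le_mul_of_nonneg_right hj (sq_nonneg _))
  -- Both copies of `C'` are replaced by `C` plus an error, one at a time, using the singular
  -- relations of `C`. The main term is λ_j² ‖p‖², to be compared with the upper bound `h2`.
  have h5 : ⟪(adj C').comp C' (f j), p⟫_ℝ = ⟪(C' - C) (f j), C' p⟫_ℝ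
      + lam j * ⟪adj (C' - C) (xi j), p⟫_ℝ + lam j ^ 2 * ‖p‖ ^ 2 := by
    have h6 : C' (f j) = (C' - C) (f j) + lam j • xi j := by
      rw [sub_apply, hC.map_f, sub_add_cancel]
    have h7 : ⟪xi j, C p⟫_ℝ = lam j * ‖p‖ ^ 2 := by
      rw [← ContinuousLinearMap.adjoint_inner_left, hC.map_xi, inner_smul_left, conj_trivial, hp,
        inner_sub_truncProj_self a ev e.orthonormal]
    rw [ContinuousLinearMap.comp_apply, ContinuousLinearMap.adjoint_inner_left, h6,
      inner_add_left, inner_smul_left, ContinuousLinearMap.adjoint_inner_left, conj_trivial,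
      sub_apply C' C p, inner_sub_right (xi j), h7]
    ring
  have h8 : -⟪(C' - C) (f j), C' p⟫_ℝ ≤ ‖(C' - C) (f j)‖ * (|lam j| * ‖p‖) :=
    (neg_le_abs _).trans ((abs_real_inner_le_norm _ _).trans
      (mul_le_mul_of_nonneg_left h4 (norm_nonneg _)))
  have h9 : -(lam j * ⟪adj (C' - C) (xi j), p⟫_ℝ)
      ≤ |lam j| * (‖adj (C' - C) (xi j)‖ * ‖p‖) := by
    refine (neg_le_abs _).trans ?_
    rw [abs_mul]
    exact mul_le_mul_of_nonneg_left (abs_real_inner_le_norm _ _) (abs_nonneg _)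
  rw [real_inner_comm, ← h1, h5] at h2
  rcases (norm_nonneg p).eq_or_lt with h0 | h0
  · rw [← h0, mul_zero]
    positivity
  · refine le_of_mul_le_mul_right ?_ h0
    nlinarith

end Operators

/-! ### Power sums and eigenvalue bounds from gaps -/

section PowerSums

/-- A telescoping substitute for the integral test. A Bernoulli inequality, from log x ≤ x - 1 and 1
+ x ≤ exp x, gives it with `(y + 1) ^ (-p)` on the left; y + 1 ≤ 2y costs the factor 2^p. -/
theorem rpow_neg_le_mul_sub {p y : ℝ} (hp : 1 < p) (hy : 1 ≤ y) :
    y ^ (-p) ≤ 2 ^ p / (p - 1) * (y ^ (1 - p) - (y + 1) ^ (1 - p)) := by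
  have hy0 : 0 < y := by linarith
  have hp1 : 0 < p - 1 := by linarith
  have hx : 0 < y / (y + 1) := by positivity
  have h1 : 1 + (p - 1) / (y + 1) ≤ (y / (y + 1)) ^ (1 - p) := by
    rw [Real.rpow_def_of_pos hx]
    have h2 := Real.log_le_sub_one_of_pos hx
    have h3 := Real.add_one_le_exp (Real.log (y / (y + 1)) * (1 - p))
    have h4 : y / (y + 1) - 1 = -(1 / (y + 1)) := by field_simp; ring
    have h5 : (p - 1) / (y + 1) = (p - 1) * (1 / (y + 1)) := by ring
    rw [h4] at h2
    nlinarith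
  have h2 : (p - 1) * (y + 1) ^ (-p) ≤ y ^ (1 - p) - (y + 1) ^ (1 - p) := by
    rw [Real.div_rpow hy0.le (by linarith), le_div_iff₀ (by positivity)] at h1
    have h3 : (y + 1) ^ (-p) = (y + 1) ^ (1 - p) / (y + 1) := by
      rw [← Real.rpow_sub_one (by positivity)]
      congr 1
      ring
    rw [h3]
    have h4 : (1 + (p - 1) / (y + 1)) * (y + 1) ^ (1 - p)
      = (y + 1) ^ (1 - p) + (p - 1) * ((y + 1) ^ (1 - p) / (y + 1)) := by ring
    linarith
  have h3 : (2 * y) ^ (-p) ≤ (y + 1) ^ (-p) :=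
    Real.rpow_le_rpow_of_nonpos (by linarith) (by linarith) (by linarith)
  rw [Real.mul_rpow (by norm_num) hy0.le, Real.rpow_neg (by norm_num)] at h3
  have h4 : y ^ (-p) = 2 ^ p / (p - 1) * ((p - 1) * (((2 : ℝ) ^ p)⁻¹ * y ^ (-p))) := by
    have : (2 : ℝ) ^ p ≠ 0 := by positivity
    field_simp
  rw [h4]
  exact mul_le_mul_of_nonneg_left ((mul_le_mul_of_nonneg_left h3 hp1.le).trans h2)
    (by positivity)

theorem sum_rpow_neg_le {p : ℝ} (hp : 1 < p) {n : ℕ} {s : Finset ℕ} (hs : ∀ j ∈ s, n ≤ j) :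
    ∑ j ∈ s, ((j : ℝ) + 1) ^ (-p) ≤ 2 ^ p / (p - 1) * ((n : ℝ) + 1) ^ (1 - p) := by
  have hp1 : 0 < p - 1 := by linarith
  have key : ∀ N, n ≤ N → ∑ j ∈ Finset.Ico n N, ((j : ℝ) + 1) ^ (-p)
      ≤ 2 ^ p / (p - 1) * (((n : ℝ) + 1) ^ (1 - p) - ((N : ℝ) + 1) ^ (1 - p)) := by
    intro N hN
    induction N, hN using Nat.le_induction with
    | base => simp
    | succ N hN ih =>
      rw [Finset.sum_Ico_succ_top hN]
      have := rpow_neg_le_mul_sub hp (y := (N : ℝ) + 1) (by linarith [N.cast_nonneg (α := ℝ)])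
      push_cast
      nlinarith
  have h1 : s ⊆ Finset.Ico n (max n (s.sup id + 1)) := by
    intro j hj
    have : j ≤ s.sup id := Finset.le_sup (f := id) hj
    rw [Finset.mem_Ico]
    exact ⟨hs j hj, lt_max_of_lt_right (by omega)⟩
  refine (Finset.sum_le_sum_of_subset_of_nonneg h1 fun j _ _ => by positivity).trans
    ((key _ (le_max_left _ _)).trans ?_)
  refine mul_le_mul_of_nonneg_left (sub_le_self _ (by positivity)) (by positivity)

/-- The exponent may be negative. Raising it to `ρ + max 0 (3 - 2 * ς) - 1`, which is nonnegative,
allows each of the K terms to be bounded by its value at K. -/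
theorem sum_range_rpow_le {ρ ς : ℝ} (hρ : 1 ≤ ρ) (K : ℕ) :
    ∑ j ∈ Finset.range K, ((j : ℝ) + 1) ^ (ρ + 2 - 2 * ς)
      ≤ (K : ℝ) ^ (ρ + max 0 (3 - 2 * ς)) := by
  rcases K.eq_zero_or_pos with hK | hK
  · subst hK
    simpa using Real.rpow_nonneg le_rfl _
  have hK' : (0 : ℝ) < K := by exact_mod_cast hK
  have hm : 0 ≤ max 0 (3 - 2 * ς) := le_max_left _ _
  have hm' : 3 - 2 * ς ≤ max 0 (3 - 2 * ς) := le_max_right _ _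
  have h1 : ∀ j ∈ Finset.range K, ((j : ℝ) + 1) ^ (ρ + 2 - 2 * ς)
      ≤ (K : ℝ) ^ (ρ + max 0 (3 - 2 * ς) - 1) := by
    intro j hj
    have hj' : (j : ℝ) + 1 ≤ K := by exact_mod_cast Finset.mem_range.1 hj
    refine (Real.rpow_le_rpow_of_exponent_le (by linarith [j.cast_nonneg (α := ℝ)])
      (by linarith)).trans (Real.rpow_le_rpow (by positivity) hj' (by linarith))
  refine (Finset.sum_le_sum h1).trans_eq ?_
  rw [Finset.sum_const, Finset.card_range, nsmul_eq_mul, Real.rpow_sub_one hK'.ne']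
  field_simp

/-- The j + 1 consecutive gaps starting at index j add up to at most `ev j`, and each is at least
the gap bound evaluated at 2(j + 1). -/
theorem rpow_le_of_gap_le {ev : ℕ → ℝ} (hev : ∀ j, 0 ≤ ev j) {c ρ : ℝ} (hc : 0 < c) (hρ : 0 ≤ ρ)
    (hgap : ∀ j : ℕ, c⁻¹ * ((j : ℝ) + 1) ^ (-ρ - 1) ≤ ev j - ev (j + 1)) (j : ℕ) :
    ((j : ℝ) + 1) ^ (-ρ) ≤ c * 2 ^ (ρ + 1) * ev j := by
  have h1 := Finset.sum_range_sub' (fun i => ev (j + i)) (j + 1)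
  have hy : (0 : ℝ) < (j : ℝ) + 1 := by positivity
  have h2 : ∀ i ∈ Finset.range (j + 1), c⁻¹ * (2 * ((j : ℝ) + 1)) ^ (-ρ - 1)
      ≤ ev (j + i) - ev (j + (i + 1)) := by
    intro i hi
    have hi' : (i : ℝ) ≤ j := by exact_mod_cast Nat.lt_succ_iff.1 (Finset.mem_range.1 hi)
    refine le_trans ?_ (hgap (j + i))
    refine mul_le_mul_of_nonneg_left ?_ (by positivity)
    refine Real.rpow_le_rpow_of_nonpos (by positivity) ?_ (by linarith)
    push_cast
    linarith
  have h3 := Finset.sum_le_sum h2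
  rw [h1, Finset.sum_const, Finset.card_range, nsmul_eq_mul, Real.mul_rpow (by norm_num) hy.le,
    Real.rpow_sub_one hy.ne', show -ρ - 1 = -(ρ + 1) by ring, Real.rpow_neg (by norm_num)] at h3
  have h4 := hev (j + (j + 1))
  have h5 : ((j + 1 : ℕ) : ℝ) * (c⁻¹ * (((2 : ℝ) ^ (ρ + 1))⁻¹ * (((j : ℝ) + 1) ^ (-ρ) / ((j : ℝ) + 1))))
      = (c * 2 ^ (ρ + 1))⁻¹ * ((j : ℝ) + 1) ^ (-ρ) := by
    push_cast
    field_simp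
  rw [h5] at h3
  rw [← inv_mul_le_iff₀ (by positivity)]
  simp only [add_zero] at h3
  linarith

end PowerSums

/-! ### Deterministic bound on the truncation bias -/

section Deterministic

variable {H : Type*} [NormedAddCommGroup H] [InnerProductSpace ℝ H]

theorem norm_sq_map_le_of_smooth {A : H →L[ℝ] H} {f : ℕ → H} {xi : HilbertBasis ℕ ℝ H}
    {c ς γ : ℝ} (hγ : 1 / 2 < γ) (hsmooth : ∀ j l : ℕ,
      |⟪A (f j), xi l⟫_ℝ| ≤ c * ((j : ℝ) + 1) ^ (-ς) * ((l : ℝ) + 1) ^ (-γ)) (j : ℕ) :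
    ‖A (f j)‖ ^ 2
      ≤ c ^ 2 * (2 ^ (2 * γ) / (2 * γ - 1)) * ((j : ℝ) + 1) ^ (-(2 * ς)) := by
  have hsq : ∀ (i : ℕ) (r : ℝ), (((i : ℝ) + 1) ^ (-r)) ^ 2 = ((i : ℝ) + 1) ^ (-(2 * r)) := by
    intro i r
    rw [← Real.rpow_natCast, ← Real.rpow_mul (by positivity)]
    congr 1
    push_cast
    ring
  refine le_of_tendsto (hasSum_sq_inner xi (A (f j))) (Eventually.of_forall fun s => ?_)
  have h1 : ∀ l ∈ s, ⟪xi l, A (f j)⟫_ℝ ^ 2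
      ≤ c ^ 2 * ((j : ℝ) + 1) ^ (-(2 * ς)) * ((l : ℝ) + 1) ^ (-(2 * γ)) := by
    intro l _
    rw [real_inner_comm, ← sq_abs, ← hsq, ← hsq, ← mul_pow, ← mul_pow]
    exact pow_le_pow_left₀ (abs_nonneg _) (hsmooth j l) 2
  refine (Finset.sum_le_sum h1).trans ?_
  rw [← Finset.mul_sum]
  have h2 := sum_rpow_neg_le (p := 2 * γ) (by linarith) (n := 0) (s := s)
    (fun _ _ => Nat.zero_le _)
  simp only [Nat.cast_zero, zero_add, Real.one_rpow, mul_one] at h2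
  calc _ ≤ c ^ 2 * ((j : ℝ) + 1) ^ (-(2 * ς)) * (2 ^ (2 * γ) / (2 * γ - 1)) :=
        mul_le_mul_of_nonneg_left h2 (by positivity)
    _ = _ := by ring

/-- Splitting of `A P`, where `P` is the projection onto the trailing sample eigenvectors, along
the leading and trailing elements of another basis. -/
theorem norm_comp_sub_truncProj_le (A : H →L[ℝ] H) (f : HilbertBasis ℕ ℝ H) (a : ℝ)
    (ev : ℕ → ℝ) {e : ℕ → H} (he : Orthonormal ℝ e) (n : ℕ) {B : ℝ} (hB : 0 ≤ B)
    (hA : ∀ s : Finset ℕ, (∀ j ∈ s, n ≤ j) → ∑ j ∈ s, ‖A (f j)‖ ^ 2 ≤ B ^ 2) :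
    ‖A.comp (ContinuousLinearMap.id ℝ H - truncProj a ev e)‖
      ≤ ∑ j ∈ Finset.range n, ‖f j - truncProj a ev e (f j)‖ * ‖A (f j)‖ + B := by
  refine ContinuousLinearMap.opNorm_le_bound _ (add_nonneg
    (Finset.sum_nonneg fun _ _ => by positivity) hB) fun v => ?_
  set p := v - truncProj a ev e v with hp
  have hap : A.comp (ContinuousLinearMap.id ℝ H - truncProj a ev e) v = A p := by
    simp [hp]
  have hpv : ‖p‖ ≤ ‖v‖ := norm_sub_truncProj_le a ev he v
  set q := ∑ j ∈ Finset.range n, ⟪f j, p⟫_ℝ • f j with hq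
  have htail : ‖A (p - q)‖ ≤ B * ‖v‖ := by
    refine (norm_map_le_of_sum_sq_le f A hB hA
      fun j hj => inner_sum_inner_smul f.orthonormal n p hj).trans ?_
    exact mul_le_mul_of_nonneg_left
      ((norm_sub_sum_inner_smul_le f.orthonormal n p).trans hpv) hB
  have hhead : ‖A q‖
      ≤ (∑ j ∈ Finset.range n, ‖f j - truncProj a ev e (f j)‖ * ‖A (f j)‖) * ‖v‖ := by
    rw [hq, map_sum, Finset.sum_mul]
    refine (norm_sum_le _ _).trans (Finset.sum_le_sum fun j _ => ?_)
    have h1 : ⟪f j, p⟫_ℝ = ⟪f j - truncProj a ev e (f j), v⟫_ℝ := by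
      rw [hp, inner_sub_left, inner_sub_right, inner_truncProj_comm]
    rw [map_smul, norm_smul, h1, mul_right_comm]
    exact mul_le_mul_of_nonneg_right (norm_inner_le_norm _ _) (norm_nonneg _)
  rw [hap, ← add_sub_cancel q p, map_add, add_mul]
  exact (norm_add_le _ _).trans (add_le_add hhead htail)

variable [CompleteSpace H]

-- The constants do not depend on `C'`, so the bound applies to every T and every sample at once,
-- with `b` of order T^(-1/2). The last hypothesis keeps the eigenvalue perturbation below half of
-- the gap bound at each retained index.
set_option maxHeartbeats 1600000 in
theorem norm_sq_comp_sub_truncProj_le {C A : H →L[ℝ] H} {lam : ℕ → ℝ}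
    {f xi : HilbertBasis ℕ ℝ H} (hC : IsSingularSystem C lam f xi) {c ρ ς γ : ℝ} (hc : 0 < c)
    (hρ : 1 ≤ ρ) (hς : 1 / 2 < ς) (hγ : 1 / 2 < γ)
    (hle : ∀ j : ℕ, lam j ^ 2 ≤ c * ((j : ℝ) + 1) ^ (-ρ))
    (hgap : ∀ j : ℕ, c⁻¹ * ((j : ℝ) + 1) ^ (-ρ - 1) ≤ lam j ^ 2 - lam (j + 1) ^ 2)
    (hsmooth : ∀ j l : ℕ,
      |⟪A (f j), xi l⟫_ℝ| ≤ c * ((j : ℝ) + 1) ^ (-ς) * ((l : ℝ) + 1) ^ (-γ)) :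
    ∃ M κ : ℝ, 0 < M ∧ 0 < κ ∧ ∀ (C' : H →L[ℝ] H) (ev : ℕ → ℝ) (e : HilbertBasis ℕ ℝ H),
      IsEigenSystem ((adj C').comp C') ev e → ∀ b a : ℝ, 0 ≤ b → 0 < a → a ≤ 1 →
      hsNorm (C' - C) ≤ ENNReal.ofReal b →
      b * (2 * ‖C‖ + b) ≤ κ * a ^ ((ρ + 1) / ρ) →
      ‖A.comp (ContinuousLinearMap.id ℝ H - truncProj a ev e)‖ ^ 2
        ≤ M * (b ^ 2 * a⁻¹ * max 1 (a ^ ((2 * ς - 3) / ρ)) + a ^ ((2 * ς - 1) / ρ)) := by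
  have hρ0 : 0 < ρ := by linarith
  have hγ1 : 0 < 2 * γ - 1 := by linarith
  have hς1 : 0 < 2 * ς - 1 := by linarith
  set B : ℝ := c ^ 2 * (2 ^ (2 * γ) / (2 * γ - 1)) with hBdef
  have hB : 0 < B := by positivity
  have hAf : ∀ j, ‖A (f j)‖ ^ 2 ≤ B * ((j : ℝ) + 1) ^ (-(2 * ς)) :=
    norm_sq_map_le_of_smooth hγ hsmooth
  set q : ℝ := max 0 (3 - 2 * ς) with hqdef
  have hq0 : 0 ≤ q := le_max_left _ _
  set M1 : ℝ := 4 * (4 * c ^ 3 * B) * (2 * c) ^ (1 + q / ρ) with hM1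
  set M2 : ℝ := B * (2 ^ (2 * ς) / (2 * ς - 1))
    * (c * 2 ^ (ρ + 1) * 2) ^ ((2 * ς - 1) / ρ) with hM2
  have hM1p : 0 < M1 := by positivity
  have hM2p : 0 < M2 := by positivity
  -- The first entry gives `η ≤ a / 2`; the second gives `hgapη`, since a retained j satisfies (j +
  -- 1)^ρ ≤ 2c/a.
  set κ : ℝ := min (1 / 2) (1 / 2 * c⁻¹ * (2 * c) ^ (-((ρ + 1) / ρ))) with hκ
  have hκp : 0 < κ := lt_min (by norm_num) (by positivity)
  refine ⟨2 * M1 + 2 * M2, κ, by positivity, hκp, ?_⟩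
  intro C' ev e h' b a hb ha ha1 hD hsmall
  set K := truncIndex a ev with hK
  set η := b * (2 * ‖C‖ + b) with hη
  have hDop : ‖C' - C‖ ≤ b := norm_le_of_hsNorm_le f hb hD
  have hΔ : ‖(adj C').comp C' - (adj C).comp C‖ ≤ η := by
    refine (norm_adj_comp_self_sub_le C C').trans ?_
    exact mul_le_mul hDop (by linarith) (by positivity) hb
  have hweyl : ∀ k, ev k ≤ lam k ^ 2 + η := fun k =>
    (h'.eigenvalue_le_add_norm_sub hC.eigen_f k).trans (by linarith)
  have hweyl' : ∀ k, lam k ^ 2 ≤ ev k + η := fun k =>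
    (hC.eigen_f.eigenvalue_le_add_norm_sub h' k).trans (by rw [norm_sub_rev]; linarith)
  have hexp : a ^ ((ρ + 1) / ρ) ≤ a := by
    refine (Real.rpow_le_rpow_of_exponent_ge ha ha1 ?_).trans_eq (Real.rpow_one a)
    rw [le_div_iff₀ hρ0]
    linarith
  have hηa : η ≤ a / 2 := by
    refine hsmall.trans ((mul_le_mul (min_le_left _ _) hexp (by positivity)
      (by norm_num)).trans_eq (by ring))
  have hidx : ∀ j, a < ev j → ((j : ℝ) + 1) ^ ρ ≤ 2 * c / a := by
    intro j hj
    have h1 := hweyl j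
    have h2 := hle j
    rw [Real.rpow_neg (by positivity), ← div_eq_mul_inv] at h2
    have h3 : a / 2 ≤ c / ((j : ℝ) + 1) ^ ρ := by linarith
    rw [le_div_iff₀ (by positivity)] at h3
    rw [le_div_iff₀ ha]
    linarith
  -- Needed for the count `K` to be genuine.
  have hfin : {j | a < ev j}.Finite := by
    refine (Set.finite_Iic ⌈(2 * c / a) ^ ρ⁻¹⌉₊).subset fun j hj => ?_
    have h1 : (j : ℝ) + 1 ≤ (2 * c / a) ^ ρ⁻¹ :=
      (Real.le_rpow_inv_iff_of_pos (by positivity) (by positivity) hρ0).2 (hidx j hj)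
    have h2 := Nat.le_ceil ((2 * c / a) ^ ρ⁻¹)
    have h3 : (j : ℝ) ≤ ⌈(2 * c / a) ^ ρ⁻¹⌉₊ := by linarith
    exact_mod_cast h3
  have hlt : ∀ j, j < K → a < ev j := fun j hj => lt_of_lt_truncIndex h'.antitone hj
  have hevK : ev K ≤ a := le_of_truncIndex_le h'.antitone hfin le_rfl
  have hgapη : ∀ j, j < K → η ≤ 1 / 2 * c⁻¹ * ((j : ℝ) + 1) ^ (-ρ - 1) := by
    intro j hj
    have h1 : κ * a ^ ((ρ + 1) / ρ) ≤ 1 / 2 * c⁻¹ * (2 * c / a) ^ (-((ρ + 1) / ρ)) := by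
      rw [Real.div_rpow (by positivity) ha.le, Real.rpow_neg ha.le, div_inv_eq_mul, ← mul_assoc]
      exact mul_le_mul_of_nonneg_right (min_le_right _ _) (by positivity)
    refine hsmall.trans (h1.trans (mul_le_mul_of_nonneg_left ?_ (by positivity)))
    have h2 : ((j : ℝ) + 1) ^ (-ρ - 1) = (((j : ℝ) + 1) ^ ρ) ^ (-((ρ + 1) / ρ)) := by
      rw [← Real.rpow_mul (by positivity)]
      congr 1
      field_simp
      ring
    rw [h2]
    refine Real.rpow_le_rpow_of_nonpos (by positivity) (hidx j (hlt j hj)) ?_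
    rw [neg_nonpos]
    positivity
  -- As j + 1 ≤ K, Weyl gives `ev K ≤ lam (j + 1) ^ 2 + η`, and η uses up at most half of the gap
  -- bound.
  have hδ : ∀ j, j < K →
      1 / 2 * c⁻¹ * ((j : ℝ) + 1) ^ (-ρ - 1) ≤ lam j ^ 2 - ev K := by
    intro j hj
    have h1 := hweyl K
    have h2 : lam K ^ 2 ≤ lam (j + 1) ^ 2 := hC.eigen_f.antitone hj
    have h3 := hgap j
    have h4 := hgapη j hj
    linarith
  set d : ℕ → ℝ := fun j => ‖(C' - C) (f j)‖ + ‖adj (C' - C) (xi j)‖ with hd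
  set r : ℕ → ℝ := fun j => |lam j| * ‖A (f j)‖ * (2 * c * ((j : ℝ) + 1) ^ (ρ + 1)) with hr
  have hterm : ∀ j ∈ Finset.range K,
      ‖f j - truncProj a ev e (f j)‖ * ‖A (f j)‖ ≤ d j * r j := by
    intro j hj
    have hj' := Finset.mem_range.1 hj
    have hg := hδ j hj'
    have hgp : 0 < 1 / 2 * c⁻¹ * ((j : ℝ) + 1) ^ (-ρ - 1) := by positivity
    have h1 := gap_mul_norm_sub_truncProj_le hC h' (a := a) (j := j) (by rw [← hK]; linarith)
    have h2 := (mul_le_mul_of_nonneg_right hg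
      (norm_nonneg (f j - truncProj a ev e (f j)))).trans h1
    have h3 : 1 / 2 * c⁻¹ * ((j : ℝ) + 1) ^ (-ρ - 1)
        = (2 * c * ((j : ℝ) + 1) ^ (ρ + 1))⁻¹ := by
      rw [show -ρ - 1 = -(ρ + 1) by ring, Real.rpow_neg (by positivity), mul_inv, mul_inv]
      norm_num
    rw [h3, inv_mul_le_iff₀ (by positivity)] at h2
    calc _ ≤ 2 * c * ((j : ℝ) + 1) ^ (ρ + 1) * (|lam j| * d j) * ‖A (f j)‖ :=
          mul_le_mul_of_nonneg_right h2 (norm_nonneg _)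
      _ = d j * r j := by rw [hr]; ring
  have hsumd : ∑ j ∈ Finset.range K, d j ^ 2 ≤ 4 * b ^ 2 := by
    have h1 := sum_sq_norm_le_of_hsNorm_le f hb hD (Finset.range K)
    have h2 := sum_sq_norm_adj_le_of_hsNorm_le xi hb hD (Finset.range K)
    have h3 : ∀ j ∈ Finset.range K, d j ^ 2
        ≤ 2 * ‖(C' - C) (f j)‖ ^ 2 + 2 * ‖adj (C' - C) (xi j)‖ ^ 2 := fun j _ => by
      simp only [hd]
      nlinarith [sq_nonneg (‖(C' - C) (f j)‖ - ‖adj (C' - C) (xi j)‖)]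
    refine (Finset.sum_le_sum h3).trans ?_
    rw [Finset.sum_add_distrib, ← Finset.mul_sum, ← Finset.mul_sum]
    linarith
  -- Exponents: -ρ from the eigenvalue, -2ς from the smoothness of `A`, 2(ρ + 1) from the inverse
  -- gap.
  have hrj : ∀ j, r j ^ 2 ≤ 4 * c ^ 3 * B * ((j : ℝ) + 1) ^ (ρ + 2 - 2 * ς) := by
    intro j
    have hy : (0 : ℝ) < (j : ℝ) + 1 := by positivity
    have h1 : r j ^ 2 = lam j ^ 2 * ‖A (f j)‖ ^ 2 * (4 * c ^ 2 * ((j : ℝ) + 1) ^ (2 * (ρ + 1))) := by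
      have : (((j : ℝ) + 1) ^ (ρ + 1)) ^ 2 = ((j : ℝ) + 1) ^ (2 * (ρ + 1)) := by
        rw [← Real.rpow_natCast, ← Real.rpow_mul hy.le]
        congr 1
        push_cast
        ring
      simp only [hr, mul_pow, sq_abs, this]
      ring
    have h2 : ((j : ℝ) + 1) ^ (ρ + 2 - 2 * ς) = ((j : ℝ) + 1) ^ (-ρ)
        * ((j : ℝ) + 1) ^ (-(2 * ς)) * ((j : ℝ) + 1) ^ (2 * (ρ + 1)) := by
      rw [← Real.rpow_add hy, ← Real.rpow_add hy]
      congr 1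
      ring
    rw [h1, h2]
    calc _ ≤ c * ((j : ℝ) + 1) ^ (-ρ) * (B * ((j : ℝ) + 1) ^ (-(2 * ς)))
          * (4 * c ^ 2 * ((j : ℝ) + 1) ^ (2 * (ρ + 1))) :=
          mul_le_mul_of_nonneg_right (mul_le_mul (hle j) (hAf j) (sq_nonneg _) (by positivity))
            (by positivity)
      _ = _ := by ring
  have hKρ : (K : ℝ) ^ ρ ≤ 2 * c / a := by
    rcases K.eq_zero_or_pos with h0 | h0
    · rw [h0, Nat.cast_zero, Real.zero_rpow hρ0.ne']
      positivity
    · have := hidx (K - 1) (hlt _ (by omega))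
      rwa [Nat.cast_sub h0, Nat.cast_one, sub_add_cancel] at this
  have hKq : (K : ℝ) ^ (ρ + q)
      ≤ (2 * c) ^ (1 + q / ρ) * (a⁻¹ * max 1 (a ^ ((2 * ς - 3) / ρ))) := by
    have h1 : (K : ℝ) ^ (ρ + q) = ((K : ℝ) ^ ρ) ^ (1 + q / ρ) := by
      rw [← Real.rpow_mul (by positivity)]
      congr 1
      field_simp
    have h2 : a ^ (-(q / ρ)) ≤ max 1 (a ^ ((2 * ς - 3) / ρ)) := by
      rcases le_total 0 (3 - 2 * ς) with h | h
      · rw [hqdef, max_eq_right h, ← neg_div, neg_sub]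
        exact le_max_right _ _
      · rw [hqdef, max_eq_left h, zero_div, neg_zero, Real.rpow_zero]
        exact le_max_left _ _
    have h3 : (2 * c / a) ^ (1 + q / ρ) = (2 * c) ^ (1 + q / ρ) * (a⁻¹ * a ^ (-(q / ρ))) := by
      rw [Real.div_rpow (by positivity) ha.le, div_eq_mul_inv, ← Real.rpow_neg ha.le, neg_add,
        Real.rpow_add ha, Real.rpow_neg_one]
    rw [h1]
    refine (Real.rpow_le_rpow (by positivity) hKρ (by positivity)).trans ?_
    rw [h3]
    gcongr
  set R := ∑ j ∈ Finset.range K, ‖f j - truncProj a ev e (f j)‖ * ‖A (f j)‖ with hR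
  have hR0 : 0 ≤ R := Finset.sum_nonneg fun _ _ => by positivity
  have hR2 : R ^ 2 ≤ M1 * (b ^ 2 * a⁻¹ * max 1 (a ^ ((2 * ς - 3) / ρ))) := by
    have h1 : R ^ 2 ≤ (∑ j ∈ Finset.range K, d j * r j) ^ 2 :=
      pow_le_pow_left₀ hR0 (Finset.sum_le_sum hterm) 2
    have h2 := Finset.sum_mul_sq_le_sq_mul_sq (Finset.range K) d r
    have h3 : ∑ j ∈ Finset.range K, r j ^ 2
        ≤ 4 * c ^ 3 * B * ((2 * c) ^ (1 + q / ρ) * (a⁻¹ * max 1 (a ^ ((2 * ς - 3) / ρ)))) := by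
      refine (Finset.sum_le_sum fun j _ => hrj j).trans ?_
      rw [← Finset.mul_sum]
      exact mul_le_mul_of_nonneg_left ((sum_range_rpow_le hρ K).trans hKq) (by positivity)
    refine h1.trans (h2.trans ((mul_le_mul hsumd h3 (Finset.sum_nonneg fun _ _ => sq_nonneg _)
      (by positivity)).trans_eq ?_))
    rw [hM1]
    ring
  set t : ℝ := B * (2 ^ (2 * ς) / (2 * ς - 1)) * ((K : ℝ) + 1) ^ (1 - 2 * ς) with ht
  have ht0 : 0 ≤ t := by positivity
  have htail : ∀ s : Finset ℕ, (∀ j ∈ s, K ≤ j) → ∑ j ∈ s, ‖A (f j)‖ ^ 2 ≤ √t ^ 2 := by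
    intro s hs
    rw [Real.sq_sqrt ht0]
    refine (Finset.sum_le_sum fun j _ => hAf j).trans ?_
    rw [← Finset.mul_sum, ht, mul_assoc B]
    exact mul_le_mul_of_nonneg_left (sum_rpow_neg_le (p := 2 * ς) (by linarith) hs) hB.le
  have ht2 : t ≤ M2 * a ^ ((2 * ς - 1) / ρ) := by
    have h1 := rpow_le_of_gap_le (fun j => sq_nonneg (lam j)) hc hρ0.le hgap K
    have h2 : lam K ^ 2 ≤ 2 * a := by linarith [hweyl' K]
    have h3 : ((K : ℝ) + 1) ^ (1 - 2 * ς) = (((K : ℝ) + 1) ^ (-ρ)) ^ ((2 * ς - 1) / ρ) := by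
      rw [← Real.rpow_mul (by positivity)]
      congr 1
      field_simp
      ring
    have h4 : ((K : ℝ) + 1) ^ (-ρ) ≤ c * 2 ^ (ρ + 1) * 2 * a := by
      refine h1.trans ((mul_le_mul_of_nonneg_left h2 (by positivity)).trans_eq (by ring))
    rw [ht, hM2, h3, mul_assoc _ _ (a ^ _), ← Real.mul_rpow (by positivity) ha.le]
    exact mul_le_mul_of_nonneg_left (Real.rpow_le_rpow (by positivity) h4 (by positivity))
      (by positivity)
  have hfinal := norm_comp_sub_truncProj_le A f a ev e.orthonormal K (Real.sqrt_nonneg t) htail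
  have hsq := pow_le_pow_left₀ (norm_nonneg _) hfinal 2
  rw [← hR] at hsq
  have hst := Real.sq_sqrt ht0
  have hX : 0 ≤ b ^ 2 * a⁻¹ * max 1 (a ^ ((2 * ς - 3) / ρ)) := by positivity
  have hY : 0 ≤ a ^ ((2 * ς - 1) / ρ) := by positivity
  refine hsq.trans ?_
  -- Uses (R + √t)² ≤ 2R² + 2t; the two products absorb the cross terms of the constants.
  nlinarith [sq_nonneg (R - √t), mul_nonneg hM1p.le hY, mul_nonneg hM2p.le hX]

end Deterministic

/-! ### Algebra of the estimator and the variance factor -/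

section Estimator

variable {H : Type*} [NormedAddCommGroup H] [InnerProductSpace ℝ H]

theorem regInverse_apply (a : ℝ) (ev : ℕ → ℝ) (e : ℕ → H) (v : H) :
    regInverse a ev e v
      = ∑ j ∈ Finset.range (truncIndex a ev), ((ev j)⁻¹ * ⟪e j, v⟫_ℝ) • e j := by
  simp [regInverse, sum_apply, tensor_apply, smul_smul]

theorem IsEigenSystem.comp_regInverse {S : H →L[ℝ] H} {ev : ℕ → ℝ} {e : HilbertBasis ℕ ℝ H}
    (h : IsEigenSystem S ev e) {a : ℝ} (ha : 0 ≤ a) :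
    S.comp (regInverse a ev e) = truncProj a ev e := by
  ext v
  rw [ContinuousLinearMap.comp_apply, regInverse_apply, map_sum, truncProj_apply]
  refine Finset.sum_congr rfl fun j hj => ?_
  have hj' := ha.trans_lt (lt_of_lt_truncIndex h.antitone (Finset.mem_range.1 hj))
  rw [map_smul, h.apply_eq, smul_smul]
  congr 1
  field_simp

variable [CompleteSpace H]

/-- With R the regularized inverse, ‖C R v‖² = ⟪R v, C* C R v⟫ and C* C R is the projection, so one
inverse eigenvalue remains per direction, not two. -/
theorem norm_sq_comp_regInverse_le {C : H →L[ℝ] H} {ev : ℕ → ℝ} {e : HilbertBasis ℕ ℝ H}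
    (h : IsEigenSystem ((adj C).comp C) ev e) {a : ℝ} (ha : 0 < a) :
    ‖C.comp (regInverse a ev e)‖ ^ 2 ≤ a⁻¹ := by
  have hbound : ‖C.comp (regInverse a ev e)‖ ≤ √a⁻¹ := by
    refine ContinuousLinearMap.opNorm_le_bound _ (Real.sqrt_nonneg _) fun v => ?_
    refine le_of_sq_le_sq ?_ (by positivity)
    rw [mul_pow, Real.sq_sqrt (by positivity), ContinuousLinearMap.comp_apply,
      ← real_inner_self_eq_norm_sq, ← ContinuousLinearMap.adjoint_inner_right]
    have h1 : (adj C) (C (regInverse a ev e v)) = truncProj a ev e v := by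
      rw [← h.comp_regInverse ha.le]
      rfl
    rw [h1, regInverse_apply, sum_inner]
    have h2 : ∀ j ∈ Finset.range (truncIndex a ev),
        ⟪((ev j)⁻¹ * ⟪e j, v⟫_ℝ) • e j, truncProj a ev e v⟫_ℝ ≤ a⁻¹ * ⟪e j, v⟫_ℝ ^ 2 := by
      intro j hj
      have h3 := inner_sub_truncProj_eq_zero a ev e.orthonormal v (Finset.mem_range.1 hj)
      have h4 := lt_of_lt_truncIndex h.antitone (Finset.mem_range.1 hj)
      rw [inner_sub_right, sub_eq_zero] at h3
      rw [inner_smul_left, ← h3, conj_trivial, mul_assoc, ← sq]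
      exact mul_le_mul_of_nonneg_right (inv_anti₀ ha h4.le) (sq_nonneg _)
    refine (Finset.sum_le_sum h2).trans ?_
    rw [← Finset.mul_sum]
    exact mul_le_mul_of_nonneg_left (sum_le_hasSum _ (fun _ _ => sq_nonneg _)
      (hasSum_sq_inner e v)) (by positivity)
  exact (pow_le_pow_left₀ (norm_nonneg _) hbound 2).trans_eq (Real.sq_sqrt (by positivity))

theorem estimator_sub_comp_truncProj {Cyz Cxz Cuz A : H →L[ℝ] H}
    (hy : adj Cyz = A.comp (adj Cxz) + adj Cuz) {ev : ℕ → ℝ} {e : HilbertBasis ℕ ℝ H}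
    (h : IsEigenSystem ((adj Cxz).comp Cxz) ev e) {a : ℝ} (ha : 0 ≤ a) :
    estimator Cyz Cxz a ev e - A.comp (truncProj a ev e)
      = (adj Cuz).comp (Cxz.comp (regInverse a ev e)) := by
  rw [estimator, hy, ContinuousLinearMap.add_comp, ← h.comp_regInverse ha, sub_eq_iff_eq_add,
    add_comm]
  rfl

theorem adj_sampleOp_eq {Ω : Type*} {A : H →L[ℝ] H} {x y z u : ℕ → Ω → H} {ω : Ω}
    (h : ∀ t, y t ω = A (x t ω) + u t ω) (T : ℕ) :
    adj (sampleOp y z T ω) = A.comp (adj (sampleOp x z T ω)) + adj (sampleOp u z T ω) := by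
  have h1 : sampleOp y z T ω = (sampleOp x z T ω).comp (adj A) + sampleOp u z T ω := by
    ext v
    simp only [sampleOp, add_apply, ContinuousLinearMap.comp_apply, smul_apply, sum_apply,
      tensor_apply, ← smul_add, ← Finset.sum_add_distrib, ← add_smul]
    congr 1
    refine Finset.sum_congr rfl fun t _ => ?_
    rw [h t, inner_add_left, ContinuousLinearMap.adjoint_inner_right]
  simp only [h1, adj, map_add, ContinuousLinearMap.adjoint_comp,
    ContinuousLinearMap.adjoint_adjoint]

end Estimator

/-! ### Calculus of stochastic orders -/

section StochasticOrder

variable {Ω : Type*} [MeasurableSpace Ω] {μ : Measure Ω}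

/-- Transfers a deterministic implication between bounds. Only monotonicity of μ is used, so the
sample eigenelements need not depend measurably on ω. -/
theorem IsBigOp.of_imp {X Y : ℕ → Ω → ℝ≥0∞} {r r' : ℕ → ℝ} (hX : IsBigOp μ X r)
    (h : ∀ M : ℝ, 0 < M → ∃ M' : ℝ, 0 < M' ∧ ∀ᶠ T in atTop, ∀ᵐ ω ∂μ,
      X T ω ≤ ENNReal.ofReal (M * r T) → Y T ω ≤ ENNReal.ofReal (M' * r' T)) :
    IsBigOp μ Y r' := by
  intro ε hε
  obtain ⟨M, hM, hMT⟩ := hX ε hε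
  obtain ⟨M', hM', hT⟩ := h M hM
  refine ⟨M', hM', ?_⟩
  filter_upwards [hMT, hT] with T h1 h2
  refine (measure_mono_ae ?_).trans h1
  filter_upwards [h2] with ω hω hY
  by_contra hcon
  exact absurd (hω (not_lt.1 hcon)) (not_le.2 hY)

theorem IsBigOp.tendsto_measure {X : ℕ → Ω → ℝ≥0∞} {r : ℕ → ℝ} (hX : IsBigOp μ X r)
    (hr : Tendsto r atTop (𝓝 0)) : IsLittleOpOne μ X := by
  intro ε hε
  rw [ENNReal.tendsto_nhds_zero]
  intro δ hδ
  obtain ⟨δ', -, hδ0, hδ'⟩ := ENNReal.lt_iff_exists_real_btwn.1 hδ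
  obtain ⟨M, hM, hMT⟩ := hX δ' (ENNReal.ofReal_pos.1 hδ0)
  have h1 : ∀ᶠ T in atTop, M * r T < ε := by
    have := hr.const_mul M
    rw [mul_zero] at this
    exact this.eventually_lt_const hε
  filter_upwards [hMT, h1] with T h2 h3
  refine (measure_mono fun ω hω => ?_).trans (h2.trans hδ'.le)
  exact (ENNReal.ofReal_le_ofReal h3.le).trans_lt hω

theorem enorm_sq_le_ofReal_iff {E : Type*} [NormedAddCommGroup E] {v : E} {b : ℝ} (hb : 0 ≤ b) :
    ‖v‖ₑ ^ 2 ≤ ENNReal.ofReal b ↔ ‖v‖ ^ 2 ≤ b := by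
  rw [← ofReal_norm, ← ENNReal.ofReal_pow (norm_nonneg _), ENNReal.ofReal_le_ofReal_iff hb]

theorem IsLittleOpOne.enorm_of_sq {E : Type*} [NormedAddCommGroup E] {X Y Z : ℕ → Ω → E}
    (hX : IsLittleOpOne μ (fun T ω => ‖X T ω‖ₑ ^ 2))
    (hY : IsLittleOpOne μ (fun T ω => ‖Y T ω‖ₑ ^ 2))
    (hZ : ∀ T ω, ‖Z T ω‖ ≤ ‖X T ω‖ + ‖Y T ω‖) : IsLittleOpOne μ (fun T ω => ‖Z T ω‖ₑ) := by
  intro ε hε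
  have h := (hX ((ε / 2) ^ 2) (by positivity)).add (hY ((ε / 2) ^ 2) (by positivity))
  rw [add_zero] at h
  refine tendsto_of_tendsto_of_tendsto_of_le_of_le tendsto_const_nhds h (fun _ => zero_le)
    fun T => (measure_mono fun ω hω => ?_).trans (measure_union_le _ _)
  have hω' : ENNReal.ofReal ε < ‖Z T ω‖ₑ := hω
  rw [← ofReal_norm, ENNReal.ofReal_lt_ofReal_iff_of_nonneg hε.le] at hω'
  by_contra hcon
  obtain ⟨h1, h2⟩ := not_or.1 hcon
  have h1 := le_of_sq_le_sq ((enorm_sq_le_ofReal_iff (by positivity)).1 (not_lt.1 h1))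
    (by positivity)
  have h2 := le_of_sq_le_sq ((enorm_sq_le_ofReal_iff (by positivity)).1 (not_lt.1 h2))
    (by positivity)
  linarith [hZ T ω]

end StochasticOrder

/-! ### Consequences of the rate of the threshold -/

section Threshold

variable {α : ℕ → ℝ} {ρ : ℝ}

theorem rpow_neg_half_sq (T : ℕ) : ((T : ℝ) ^ (-(1 / 2) : ℝ)) ^ 2 = (T : ℝ)⁻¹ := by
  rw [← Real.rpow_natCast, ← Real.rpow_mul T.cast_nonneg, ← Real.rpow_neg_one]
  norm_num

/-- The rate condition raised to the power (ρ + 1)/ρ, which turns the exponent ρ/(2ρ + 2) of T into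
1/2. -/
theorem tendsto_rpow_neg_half_mul_inv (hρ : 0 < ρ) (hα_pos : ∀ T, 0 < α T)
    (hα_rate : (fun T => (α T)⁻¹) =o[atTop] fun T : ℕ => (T : ℝ) ^ (ρ / (2 * ρ + 2))) :
    Tendsto (fun T : ℕ => (T : ℝ) ^ (-(1 / 2) : ℝ) * (α T ^ ((ρ + 1) / ρ))⁻¹) atTop (𝓝 0) := by
  have hp : 0 < (ρ + 1) / ρ := by positivity
  have h := hα_rate.tendsto_div_nhds_zero.rpow_const (p := (ρ + 1) / ρ) (Or.inr hp.le)
  rw [Real.zero_rpow hp.ne'] at h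
  refine h.congr fun T => ?_
  have hT : (0 : ℝ) ≤ T := T.cast_nonneg
  rw [Real.div_rpow (inv_nonneg.2 (hα_pos T).le) (by positivity), Real.inv_rpow (hα_pos T).le,
    ← Real.rpow_mul hT, Real.rpow_neg hT, div_eq_mul_inv, mul_comm]
  congr 3
  field_simp

/-- Squaring the previous limit gives T⁻¹ α^(-2-2/ρ) → 0. This dominates: for α ≤ 1 the maximum is
at most α^(-1-2/ρ), because 2ς - 1 + ρ ≥ 0. -/
theorem tendsto_inv_mul_inv_mul_max (hρ : 0 < ρ) {ς : ℝ} (hς : 1 / 2 < ς)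
    (hα_pos : ∀ T, 0 < α T) (hα_zero : Tendsto α atTop (𝓝 0))
    (hα_rate : (fun T => (α T)⁻¹) =o[atTop] fun T : ℕ => (T : ℝ) ^ (ρ / (2 * ρ + 2))) :
    Tendsto (fun T : ℕ => (T : ℝ)⁻¹ * (α T)⁻¹ * max 1 (α T ^ ((2 * ς - 3) / ρ)))
      atTop (𝓝 0) := by
  have h := (tendsto_rpow_neg_half_mul_inv hρ hα_pos hα_rate).pow 2
  rw [zero_pow two_ne_zero] at h
  refine tendsto_of_tendsto_of_tendsto_of_le_of_le' tendsto_const_nhds h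
    (Eventually.of_forall fun T => ?_) ?_
  · have := hα_pos T
    positivity
  filter_upwards [hα_zero.eventually_le_const one_pos] with T hT
  have ha := hα_pos T
  rw [mul_pow, rpow_neg_half_sq, mul_assoc]
  refine mul_le_mul_of_nonneg_left ?_ (by positivity)
  have h1 : ((α T ^ ((ρ + 1) / ρ))⁻¹) ^ 2 = (α T)⁻¹ * α T ^ (-(1 + 2 / ρ)) := by
    rw [← Real.rpow_neg ha.le, ← Real.rpow_natCast, ← Real.rpow_mul ha.le, ← Real.rpow_neg_one,
      ← Real.rpow_add ha]
    congr 1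
    push_cast
    field_simp
    ring
  rw [h1]
  refine mul_le_mul_of_nonneg_left (max_le ?_ ?_) (by positivity)
  · refine Real.one_le_rpow_of_pos_of_le_one_of_nonpos ha hT ?_
    rw [neg_nonpos]
    positivity
  · refine Real.rpow_le_rpow_of_exponent_ge ha hT ?_
    rw [neg_le_iff_add_nonneg]
    have : (2 * ς - 3) / ρ + (1 + 2 / ρ) = (2 * ς - 1 + ρ) / ρ := by
      field_simp
      ring
    rw [this]
    exact div_nonneg (by linarith) hρ.le

end Threshold

end FIVE

/-! ### The theorem: from deterministic bounds to stochastic orders -/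

theorem theorem3
    {H : Type*} [NormedAddCommGroup H] [InnerProductSpace ℝ H] [CompleteSpace H]
    [TopologicalSpace.SeparableSpace H] [MeasurableSpace H] [BorelSpace H]
    {Ω : Type*} [MeasurableSpace Ω] (μ : Measure Ω) [IsProbabilityMeasure μ]
    (A : H →L[ℝ] H) (x y z u : ℕ → Ω → H)
    (lam : ℕ → ℝ) (f xi : HilbertBasis ℕ ℝ H)
    (hsys : FIVE.IsSingularSystem (FIVE.popOp μ (x 0) (z 0)) lam f xi)
    (c ρ ς γ m : ℝ)
    (hass : FIVE.RateAssumption μ A x y z u lam f xi c ρ ς γ m)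
    (α : ℕ → ℝ) (hα_pos : ∀ T, 0 < α T) (hα_zero : Tendsto α atTop (𝓝 0))
    (hα_rate : (fun T => (α T)⁻¹) =o[atTop] fun T : ℕ => (T : ℝ) ^ (ρ / (2 * ρ + 2)))
    (lamHatSq : ℕ → Ω → ℕ → ℝ) (fHat : ℕ → Ω → HilbertBasis ℕ ℝ H)
    (hhat : ∀ T ω, FIVE.IsEigenSystem
      ((FIVE.adj (FIVE.sampleOp x z T ω)).comp (FIVE.sampleOp x z T ω))
      (lamHatSq T ω) (fHat T ω))
    (AHat PiHat : ℕ → Ω → H →L[ℝ] H)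
    (hAHat : ∀ T ω, AHat T ω = FIVE.estimator (FIVE.sampleOp y z T ω) (FIVE.sampleOp x z T ω)
      (α T) (lamHatSq T ω) (fHat T ω))
    (hPiHat : ∀ T ω, PiHat T ω = FIVE.truncProj (α T) (lamHatSq T ω) (fHat T ω)) :
    FIVE.IsBigOp μ (fun T ω => ‖AHat T ω - A.comp (PiHat T ω)‖ₑ ^ 2)
        (fun T => (T : ℝ)⁻¹ * (α T)⁻¹) ∧
      FIVE.IsBigOp μ
        (fun T ω => ‖A.comp (ContinuousLinearMap.id ℝ H - PiHat T ω)‖ₑ ^ 2)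
        (fun T => (T : ℝ)⁻¹ * (α T)⁻¹ * max 1 (α T ^ ((2 * ς - 3) / ρ))
          + α T ^ ((2 * ς - 1) / ρ)) ∧
      FIVE.IsLittleOpOne μ (fun T ω => ‖AHat T ω - A‖ₑ) := by
  have hρ : 2 < ρ := hass.two_lt_ρ
  have hρ0 : 0 < ρ := by linarith
  have hς : 1 / 2 < ς := hass.half_lt_ς
  have hmodel : ∀ᵐ ω ∂μ, ∀ t, y t ω = A (x t ω) + u t ω :=
    ae_all_iff.2 hass.base.isModel.model
  have hfirst : FIVE.IsBigOp μ (fun T ω => ‖AHat T ω - A.comp (PiHat T ω)‖ₑ ^ 2)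
      (fun T => (T : ℝ)⁻¹ * (α T)⁻¹) := by
    refine hass.base.rate_uz.of_imp fun M hM => ⟨M ^ 2, by positivity, ?_⟩
    refine Eventually.of_forall fun T => ?_
    filter_upwards [hmodel] with ω hω hb
    have ha := hα_pos T
    -- Validity of the instrument turns the rate of the deviation into a rate for the sample
    -- operator itself.
    rw [hass.base.isModel.valid 0, sub_zero] at hb
    have h1 : ‖FIVE.sampleOp u z T ω‖ ≤ M * (T : ℝ) ^ (-(1 / 2) : ℝ) :=
      FIVE.norm_le_of_hsNorm_le f (by positivity) hb
    rw [FIVE.enorm_sq_le_ofReal_iff (by positivity), hAHat, hPiHat,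
      FIVE.estimator_sub_comp_truncProj (FIVE.adj_sampleOp_eq hω T) (hhat T ω) ha.le]
    refine (pow_le_pow_left₀ (norm_nonneg _) (ContinuousLinearMap.opNorm_comp_le _ _) 2).trans ?_
    have h2 := pow_le_pow_left₀ (norm_nonneg _) h1 2
    rw [mul_pow, FIVE.rpow_neg_half_sq] at h2
    rw [mul_pow, LinearIsometryEquiv.norm_map, ← mul_assoc]
    exact mul_le_mul h2 (FIVE.norm_sq_comp_regInverse_le (hhat T ω) ha) (sq_nonneg _)
      (by positivity)
  have hsecond : FIVE.IsBigOp μ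
      (fun T ω => ‖A.comp (ContinuousLinearMap.id ℝ H - PiHat T ω)‖ₑ ^ 2)
      (fun T => (T : ℝ)⁻¹ * (α T)⁻¹ * max 1 (α T ^ ((2 * ς - 3) / ρ))
        + α T ^ ((2 * ς - 1) / ρ)) := by
    obtain ⟨M₀, κ, hM₀, hκ, hdet⟩ := FIVE.norm_sq_comp_sub_truncProj_le hsys hass.c_pos
      (by linarith) hς hass.half_lt_γ hass.eigenvalue_le hass.gap_le hass.smooth
    -- Taking b = M T^(-1/2) puts M² on the first term only; 1 + M² covers both terms.
    refine hass.base.rate_xz.of_imp fun M hM => ⟨M₀ * (1 + M ^ 2), by positivity, ?_⟩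
    set C := FIVE.popOp μ (x 0) (z 0) with hC
    -- For T ≥ 1, b(2‖C‖ + b) ≤ M(2‖C‖ + M) T^(-1/2), so this limit yields the smallness hypothesis
    -- for all large T.
    have hsmall := (FIVE.tendsto_rpow_neg_half_mul_inv hρ0 hα_pos hα_rate).const_mul
      (M * (2 * ‖C‖ + M))
    rw [mul_zero] at hsmall
    filter_upwards [hsmall.eventually_le_const hκ, hα_zero.eventually_le_const one_pos,
      eventually_ge_atTop 1] with T h1 h2 hT
    refine Eventually.of_forall fun ω hb => ?_
    have ha := hα_pos T
    have hT1 : (T : ℝ) ^ (-(1 / 2) : ℝ) ≤ 1 :=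
      Real.rpow_le_one_of_one_le_of_nonpos (by exact_mod_cast hT) (by norm_num)
    have hTp : 0 ≤ (T : ℝ) ^ (-(1 / 2) : ℝ) := by positivity
    have hη : M * (T : ℝ) ^ (-(1 / 2) : ℝ) * (2 * ‖C‖ + M * (T : ℝ) ^ (-(1 / 2) : ℝ))
        ≤ κ * α T ^ ((ρ + 1) / ρ) := by
      rw [← mul_assoc, mul_inv_le_iff₀ (by positivity)] at h1
      refine le_trans ?_ h1
      have h3 : M * (T : ℝ) ^ (-(1 / 2) : ℝ) ≤ M := mul_le_of_le_one_right hM.le hT1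
      calc _ ≤ M * (T : ℝ) ^ (-(1 / 2) : ℝ) * (2 * ‖C‖ + M) :=
            mul_le_mul_of_nonneg_left (by linarith) (by positivity)
        _ = _ := by ring
    have hmain := hdet _ _ _ (hhat T ω) _ _ (by positivity) ha h2 hb hη
    rw [FIVE.enorm_sq_le_ofReal_iff (by positivity), hPiHat]
    refine hmain.trans ?_
    rw [mul_pow, FIVE.rpow_neg_half_sq, mul_assoc M₀]
    refine mul_le_mul_of_nonneg_left ?_ hM₀.le
    have hX : 0 ≤ (T : ℝ)⁻¹ * (α T)⁻¹ * max 1 (α T ^ ((2 * ς - 3) / ρ)) := by positivity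
    have hY : 0 ≤ α T ^ ((2 * ς - 1) / ρ) := by positivity
    have hMY := mul_nonneg (sq_nonneg M) hY
    linarith
  refine ⟨hfirst, hsecond, ?_⟩
  have hmax := FIVE.tendsto_inv_mul_inv_mul_max hρ0 hς hα_pos hα_zero hα_rate
  have hpow : Tendsto (fun T => α T ^ ((2 * ς - 1) / ρ)) atTop (𝓝 0) := by
    have hexp : 0 < (2 * ς - 1) / ρ := div_pos (by linarith) hρ0
    have := hα_zero.rpow_const (p := (2 * ς - 1) / ρ) (Or.inr hexp.le)
    rwa [Real.zero_rpow hexp.ne'] at this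
  have hinv : Tendsto (fun T : ℕ => (T : ℝ)⁻¹ * (α T)⁻¹) atTop (𝓝 0) := by
    refine tendsto_of_tendsto_of_tendsto_of_le_of_le tendsto_const_nhds hmax (fun T => ?_)
      fun T => ?_
    · have := hα_pos T
      positivity
    · have := hα_pos T
      exact le_mul_of_one_le_right (by positivity) (le_max_left _ _)
  have hsum := hmax.add hpow
  rw [add_zero] at hsum
  refine FIVE.IsLittleOpOne.enorm_of_sq (hfirst.tendsto_measure hinv)
    (hsecond.tendsto_measure hsum) fun T ω => ?_
  have : AHat T ω - A = (AHat T ω - A.comp (PiHat T ω))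
      - A.comp (ContinuousLinearMap.id ℝ H - PiHat T ω) := by
    rw [ContinuousLinearMap.comp_sub, ContinuousLinearMap.comp_id]
    abel
  rw [this]
  exact norm_sub_le _ _
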